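/- **Model.** A site with height at least $2$ is unstable and may topple: it loses two particles and, according to its label, sends two particles to its left neighbour ($l$), two to its right neighbour ($r$), or one to each neighbour ($s$). Let $\nu$ be a translation-invariant and ergodic probability measure on environments $\zeta\in\{l,r,s\}^{\mathbb Z}$. Assume that $\nu$ is directed, i.e. $\nu(\zeta(0)=r)=0$ or $\nu(\zeta(0)=l)=0$, and that for all $x\in\mathbb Z$ $$\nu(\zeta(x)=\zeta(x+1)=s)=0\quad\text{and}\quad \nu(\zeta(x)=\zeta(x+2)=s)=0 .$$ Put $f_r=\nu(\zeta(0)\ne s)$ (which equals $\nu(\zeta(0)=r)$ when the label $l$ has probability zero). *Stationary density.* Let $\mu$ be a probability measure on $\{0,1\}^{\mathbb N}$. On $I_n=\{0,\dots,n\}$ start from the restriction to $I_n$ of a sample of $\mu$, in the environment given by the restriction to $I_n$ of an independent sample of $\nu$; at each time step add one particle at an independent, uniformly chosen site of $I_n$ and topple unstable sites until the configuration is stable (all heights are $0$ or $1$); particles sent outside $I_n$ are lost. Let $\rho_n^t$ be the expected fraction of sites of $I_n$ with height $1$ at time $t$, and $\rho_s=\rho_s(\mu,\nu)=\lim_{n\to\infty}\lim_{t\to\infty}\rho_n^t$.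 *Transition density.* On $\mathbb Z$ let the initial heights $\eta$ have law $\mu_\rho$, the product of Poisson measures with parameter $\rho\ge 0$, independent of $\zeta\sim\nu$; at each time step all unstable sites topple once. The state $(\eta,\zeta)$ is stabilizable if every site topples only finitely often. Let $\rho_{tr}=\sup\{\rho\ge 0: (\eta,\zeta)\text{ is stabilizable }(\mu_\rho\times\nu)\text{-a.s.}\}$. **Theorem.** Under these assumptions: (a) for every $\mu$, the limit $\lim_{t\to\infty}\rho_n^t$ exists for every $n\ge 1$, the limit $\rho_s$ exists, and $\rho_s=1-\frac{f_r}{2}$; (b) $\rho_{tr}$ is finite and is the unique solution $\rho\ge 0$ of $$\rho-\tfrac12\bigl(1-e^{-2\rho}\bigr)=\tfrac{1-f_r}{2}\bigl(1+e^{-2\rho}\bigr)^2 .$$ In particular, $\rho_s\neq\rho_{tr}$. -/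

import Mathlib

open MeasureTheory ProbabilityTheory Filter Topology

namespace Sandpile

/-- Toppling labels: left, right, symmetric. -/
inductive Label : Type
  | l : Label
  | r : Label
  | s : Label
  deriving DecidableEq

instance : MeasurableSpace Label := ⊤

/-- `a.sent d` is the number of particles which a toppling of type `a` at a site `x` sends to the
site `x + d`. -/
def Label.sent : Label → ℤ → ℕ
  | Label.l, d => if d = -1 then 2 else 0
  | Label.r, d => if d = 1 then 2 else 0
  | Label.s, d => if d = -1 ∨ d = 1 then 1 else 0

/-! ### Driven model on the interval `I_n = {0, …, n}` -/

/-- Height configuration after one toppling of the site `x` on `{0, …, n}`, in the environment `ζ`;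
particles sent outside the interval are lost. -/
def topple {n : ℕ} (ζ : Fin (n + 1) → Label) (η : Fin (n + 1) → ℕ) (x : Fin (n + 1)) :
    Fin (n + 1) → ℕ :=
  fun y => (η y - if y = x then 2 else 0) + (ζ x).sent ((y : ℤ) - (x : ℤ))

/-- `ξ` results from `η` by one legal toppling, i.e. the toppling of an unstable site. -/
def LegalTopple {n : ℕ} (ζ : Fin (n + 1) → Label) (η ξ : Fin (n + 1) → ℕ) : Prop :=
  ∃ x, 2 ≤ η x ∧ ξ = topple ζ η x

/-- All sites have height `0` or `1`. -/
def IsStable {n : ℕ} (η : Fin (n + 1) → ℕ) : Prop := ∀ x, η x ≤ 1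

/-- `ξ` is a stable configuration reached from `η` by finitely many legal topplings. -/
def StabilizesTo {n : ℕ} (ζ : Fin (n + 1) → Label) (η ξ : Fin (n + 1) → ℕ) : Prop :=
  Relation.ReflTransGen (LegalTopple ζ) η ξ ∧ IsStable ξ

/-- Abelian property: the stable configuration does not depend on the order of the topplings. -/
theorem StabilizesTo.unique {n : ℕ} {ζ : Fin (n + 1) → Label} {η ξ ξ' : Fin (n + 1) → ℕ}
    (h : StabilizesTo ζ η ξ) (h' : StabilizesTo ζ η ξ') : ξ = ξ' := by
  have stuck : ∀ {a b : Fin (n + 1) → ℕ}, IsStable a →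
      Relation.ReflTransGen (LegalTopple ζ) a b → a = b := by
    intro a b ha hab
    rcases Relation.ReflTransGen.cases_head hab with e | ⟨c, ⟨x, hx, _⟩, _⟩
    · exact e
    · have := ha x
      omega
  obtain ⟨d, h1, h2⟩ := Relation.church_rosser (r := LegalTopple ζ) (by
    rintro a b c ⟨x, hx, rfl⟩ ⟨y, hy, rfl⟩
    by_cases hxy : x = y
    · subst hxy
      exact ⟨_, Relation.ReflGen.refl, Relation.ReflTransGen.refl⟩
    · refine ⟨topple ζ (topple ζ a x) y, Relation.ReflGen.single ⟨y, ?_, rfl⟩,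
        Relation.ReflTransGen.single ⟨x, ?_, ?_⟩⟩
      · simp only [topple, if_neg (Ne.symm hxy)]
        omega
      · simp only [topple, if_neg hxy]
        omega
      · funext z
        simp only [topple]
        by_cases hzx : z = x
        · subst hzx
          simp only [if_neg hxy, if_true]
          omega
        · by_cases hzy : z = y
          · subst hzy
            simp only [if_neg hzx, if_true]
            omega
          · simp only [if_neg hzx, if_neg hzy]
            omega) h.1 h'.1
  rw [stuck h.2 h1, stuck h'.2 h2]

open Classical in
/-- The stabilization of `η` in the environment `ζ`. In environments in which `η` cannot be
stabilized (which need both a label `l` and a label `r`) the value is irrelevant, and set to `η`. -/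
noncomputable def stabilize {n : ℕ} (ζ : Fin (n + 1) → Label) (η : Fin (n + 1) → ℕ) :
    Fin (n + 1) → ℕ :=
  if h : ∃ ξ, StabilizesTo ζ η ξ then h.choose else η

/-- The driven process: the configuration at time `t` when the initial configuration is `η` and the
successive additions take place at the sites `a 0, …, a (t - 1)`; after each addition the
configuration is stabilized. -/
noncomputable def drivenConfig {n : ℕ} (ζ : Fin (n + 1) → Label) (η : Fin (n + 1) → ℕ) :
    (t : ℕ) → (Fin t → Fin (n + 1)) → Fin (n + 1) → ℕ
  | 0, _ => η
  | t + 1, a =>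
      stabilize ζ (drivenConfig ζ η t (fun i => a i.castSucc) + Pi.single (a (Fin.last t)) 1)

/-- Fraction of the sites of `{0, …, n}` whose height is `1`. -/
noncomputable def occupiedFraction {n : ℕ} (η : Fin (n + 1) → ℕ) : ℝ :=
  ((Finset.univ.filter fun x => η x = 1).card : ℝ) / (n + 1)

/-- `ρ_n^t(μ, ν)`: the expected fraction of sites of `{0, …, n}` with height `1` at time `t`. The
initial configuration and the environment are the restrictions to `{0, …, n}` of independent samples
from `μ` and `ν`, and the first `t` addition sites are uniform on `{0, …, n}^t`. -/
noncomputable def expectedDensity (μ : Measure (ℕ → Fin 2)) (ν : Measure (ℤ → Label)) (n t : ℕ) :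
    ℝ :=
  ∫ p : (ℕ → Fin 2) × (ℤ → Label),
    (∑ a : Fin t → Fin (n + 1),
      occupiedFraction (drivenConfig (fun x : Fin (n + 1) => p.2 ((x : ℕ) : ℤ))
        (fun x : Fin (n + 1) => (p.1 (x : ℕ) : ℕ)) t a)) / ((n : ℝ) + 1) ^ t
    ∂(μ.prod ν)

/-- `ρ_s(μ, ν)` exists and equals `ρ`: the iterated limit `lim_{n → ∞} lim_{t → ∞} ρ_n^t` exists and
equals `ρ`. (On the one-point interval, `n = 0`, the process alternates deterministically between
the heights `0` and `1`, so the inner limit is required for `n ≥ 1`.) -/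
def IsStationaryDensity (μ : Measure (ℕ → Fin 2)) (ν : Measure (ℤ → Label)) (ρ : ℝ) : Prop :=
  ∃ L : ℕ → ℝ, (∀ n, 1 ≤ n → Tendsto (fun t => expectedDensity μ ν n t) atTop (𝓝 (L n))) ∧
    Tendsto L atTop (𝓝 ρ)

/-! ### Infinite volume model on `ℤ` -/

/-- One step of the parallel dynamics on `ℤ`: every unstable site topples once. -/
def parallelStep (ζ : ℤ → Label) (η : ℤ → ℕ) : ℤ → ℕ := fun x =>
  (η x - if 2 ≤ η x then 2 else 0)
    + (if 2 ≤ η (x - 1) then (ζ (x - 1)).sent 1 else 0)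
    + (if 2 ≤ η (x + 1) then (ζ (x + 1)).sent (-1) else 0)

/-- The state `(η, ζ)` is stabilizable: every site topples only finitely many times. -/
def Stabilizable (η : ℤ → ℕ) (ζ : ℤ → Label) : Prop :=
  ∀ x : ℤ, {t : ℕ | 2 ≤ ((parallelStep ζ)^[t] η) x}.Finite

/-- The product over `ℤ` of Poisson measures with parameter `ρ`. -/
noncomputable def poissonField (ρ : NNReal) : Measure (ℤ → ℕ) :=
  Measure.infinitePi fun _ : ℤ => poissonMeasure ρ

/-- The parameters `ρ ≥ 0` for which `(η, ζ)` is stabilizable almost surely under `μ_ρ × ν`. -/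
def stabilizingParameters (ν : Measure (ℤ → Label)) : Set ℝ :=
  {ρ | 0 ≤ ρ ∧ ∀ᵐ p ∂((poissonField ρ.toNNReal).prod ν), Stabilizable p.1 p.2}

/-- `ρ_tr(ν) = ρ`: the set of parameters `ρ` with almost sure stabilization has supremum `ρ`. -/
def IsTransitionDensity (ν : Measure (ℤ → Label)) (ρ : ℝ) : Prop :=
  IsLUB (stabilizingParameters ν) ρ

/-! ### Conditions on the law of the environment -/

/-- The translation of environments on `ℤ`. -/
def shift (ζ : ℤ → Label) : ℤ → Label := fun x => ζ (x + 1)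

/-- One of the labels `r`, `l` has probability zero. -/
def IsDirected (ν : Measure (ℤ → Label)) : Prop :=
  ν {ζ | ζ 0 = Label.r} = 0 ∨ ν {ζ | ζ 0 = Label.l} = 0

/-- Any two labels `s` are separated by at least two other labels. -/
def IsRestricted (ν : Measure (ℤ → Label)) : Prop :=
  ∀ x : ℤ, ν {ζ | ζ x = Label.s ∧ ζ (x + 1) = Label.s} = 0 ∧
    ν {ζ | ζ x = Label.s ∧ ζ (x + 2) = Label.s} = 0

/-- `f_r`, the density of labels different from `s`. If the label `l` has probability zero, this is
the density of the label `r`. -/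
noncomputable def directedFraction (ν : Measure (ℤ → Label)) : ℝ :=
  ν.real {ζ | ζ 0 ≠ Label.s}

end Sandpile

/-!
By reflection, we may assume that the label `l` does not occur.

*Stationary density.* If `α (x - 1) * α (x + 1) = α x ^ 2` at each site `x` with label `s` and
`α (x + 1) ^ 2 = α x ^ 2` at each site `x` with label `r`, where `α = 1` outside the interval, then
the character `∏ x, α x ^ η x` does not change when a site topples. Its expectation is therefore
multiplied by the average of `α` at each time step, and decays if `α` is not constant. Since labels
`s` are isolated, one can take `α = -1` at a single site and `α = 1` elsewhere, unless the site is a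
neighbour of a label `s`; thus every other site is occupied with limiting probability `1/2`. The
left neighbour of a label `s` remains occupied once it has been, and taking `α = -1` at both
neighbours shows that the right one is occupied with limiting probability `1/2`. A label `s` at the
left end of the interval has no left neighbour, and there `α` takes the values `I, -1` on the label
`s` and its right neighbour.

*Transition density.* By the least action principle, a state is stabilizable if and only if some
number of topplings of each site, legal or not, leaves all heights at most `1`. Pairs of particles
travel to the right like customers of a queue: `⌊η x / 2⌋` of them arrive at `x`, and a label `s`
serves one of them exactly when both of its neighbours have even height. The state is stabilizable
if and only if the stationary queue is finite. By ergodicity this depends on whether the arrival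
rate `(ρ - (1 - exp (-2ρ)) / 2) / 2` is smaller than the service rate
`ν(s) ((1 + exp (-2ρ)) / 2) ^ 2`, and `ρ_tr` is the density at which the two rates agree.
-/

namespace Sandpile

open scoped BigOperators ENNReal NNReal Nat

section Termination

variable {n : ℕ}

theorem Label.sent_eq_add (a : Label) (d : ℤ) :
    a.sent d = (if d = -1 then a.sent (-1) else 0) + if d = 1 then a.sent 1 else 0 := by
  cases a <;> simp only [Label.sent] <;> split_ifs <;> simp_all

theorem sum_ite_coe_eq_le (z : ℤ) (c : ℕ) :
    ∑ y : Fin (n + 1), (if (y : ℤ) = z then c else 0) ≤ c := by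
  by_cases h : ∃ x : Fin (n + 1), (x : ℤ) = z
  · obtain ⟨x, rfl⟩ := h
    simp [Fin.val_inj]
  · push Not at h
    simp [h]

theorem sum_mul_sent_le (g : ℤ → ℕ) (a : Label) (x : Fin (n + 1)) :
    ∑ y : Fin (n + 1), g y * a.sent (y - x) ≤
      g (x - 1) * a.sent (-1) + g (x + 1) * a.sent 1 := by
  have hterm : ∀ y : Fin (n + 1), g y * a.sent (y - x) =
      (if (y : ℤ) = x - 1 then g (x - 1) * a.sent (-1) else 0) +
        if (y : ℤ) = x + 1 then g (x + 1) * a.sent 1 else 0 := by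
    intro y
    rw [Label.sent_eq_add, mul_add]
    by_cases hl : (y : ℤ) = x - 1
    · simp [hl, show (x : ℤ) - 1 ≠ x + 1 by omega]
    · by_cases hr : (y : ℤ) = x + 1
      · simp [hr, show (x : ℤ) + 1 ≠ x - 1 by omega]
      · simp [hl, hr, show (y : ℤ) - x ≠ -1 by omega, show (y : ℤ) - x ≠ 1 by omega]
  simp only [hterm, Finset.sum_add_distrib]
  exact add_le_add (sum_ite_coe_eq_le _ _) (sum_ite_coe_eq_le _ _)

/-- A strictly concave and decreasing weight on the sites: the total weight of the particles
strictly decreases whenever a site with a label other than `l` topples. -/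
def toppleWeight (n : ℕ) (z : ℤ) : ℕ := ((n + 2) ^ 2 - (z + 1) ^ 2 : ℤ).toNat

theorem coe_toppleWeight {z : ℤ} (h : -1 ≤ z) (h' : z ≤ n + 1) :
    (toppleWeight n z : ℤ) = (n + 2) ^ 2 - (z + 1) ^ 2 :=
  Int.toNat_of_nonneg (by nlinarith)

theorem toppleWeight_mul_sent_lt {a : Label} (ha : a ≠ Label.l) (x : Fin (n + 1)) :
    toppleWeight n (x - 1) * a.sent (-1) + toppleWeight n (x + 1) * a.sent 1 <
      toppleWeight n x * 2 := by
  have hx : (x : ℤ) ≤ n := by omega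
  zify
  rw [coe_toppleWeight (by omega) (by omega), coe_toppleWeight (by omega) (by omega),
    coe_toppleWeight (by omega) (by omega)]
  cases a with
  | l => exact absurd rfl ha
  | r => simp [Label.sent]; nlinarith
  | s => simp [Label.sent]; nlinarith

variable {ζ : Fin (n + 1) → Label} {η ξ : Fin (n + 1) → ℕ}

theorem sub_add_of_two_le {x : Fin (n + 1)} (hx : 2 ≤ η x) (y : Fin (n + 1)) :
    (η y - if y = x then 2 else 0) + (if y = x then 2 else 0) = η y := by
  split_ifs with h
  · subst h
    omega
  · rfl

theorem sum_toppleWeight_mul_topple_lt (hζ : ∀ x, ζ x ≠ Label.l) {x : Fin (n + 1)}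
    (hx : 2 ≤ η x) :
    ∑ y : Fin (n + 1), toppleWeight n y * topple ζ η x y <
      ∑ y : Fin (n + 1), toppleWeight n y * η y := by
  have hη : ∑ y : Fin (n + 1), toppleWeight n y * η y =
      ∑ y : Fin (n + 1), toppleWeight n y * (η y - if y = x then 2 else 0) +
        toppleWeight n x * 2 := by
    conv_lhs => enter [2, y]; rw [← sub_add_of_two_le hx y, mul_add]
    simp [Finset.sum_add_distrib]
  rw [hη]
  simp only [topple, mul_add, Finset.sum_add_distrib]
  gcongr
  exact (sum_mul_sent_le _ _ _).trans_lt (toppleWeight_mul_sent_lt (hζ x) x)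

theorem exists_stabilizesTo (hζ : ∀ x, ζ x ≠ Label.l) (η : Fin (n + 1) → ℕ) :
    ∃ ξ, StabilizesTo ζ η ξ := by
  induction h : ∑ y : Fin (n + 1), toppleWeight n y * η y using Nat.strong_induction_on
    generalizing η with
  | _ k ih =>
    by_cases hstable : IsStable η
    · exact ⟨η, Relation.ReflTransGen.refl, hstable⟩
    · obtain ⟨x, hx⟩ := not_forall.1 hstable
      rw [not_le] at hx
      obtain ⟨ξ, hreach, hξ⟩ := ih _ (h ▸ sum_toppleWeight_mul_topple_lt hζ hx) _ rfl
      exact ⟨ξ, hreach.head ⟨x, hx, rfl⟩, hξ⟩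

theorem stabilizesTo_stabilize (h : ∃ ξ, StabilizesTo ζ η ξ) :
    StabilizesTo ζ η (stabilize ζ η) := by
  rw [stabilize, dif_pos h]
  exact h.choose_spec

theorem stabilizesTo_drivenConfig_succ (hζ : ∀ x, ζ x ≠ Label.l) (η : Fin (n + 1) → ℕ) {t : ℕ}
    (a : Fin (t + 1) → Fin (n + 1)) :
    StabilizesTo ζ (drivenConfig ζ η t (fun i => a i.castSucc) + Pi.single (a (Fin.last t)) 1)
      (drivenConfig ζ η (t + 1) a) :=
  stabilizesTo_stabilize (exists_stabilizesTo hζ _)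

theorem isStable_drivenConfig (hζ : ∀ x, ζ x ≠ Label.l) (hη : IsStable η) :
    ∀ {t : ℕ} (a : Fin t → Fin (n + 1)), IsStable (drivenConfig ζ η t a)
  | 0, _ => hη
  | _ + 1, a => (stabilizesTo_drivenConfig_succ hζ η a).2

end Termination

section Characters

variable {n : ℕ}

/-- The character of the free abelian group on the sites which takes the value `α x` on a particle
at `x`, evaluated at the height configuration `η`. -/
def heightChar {M : Type*} [CommMonoid M] (α : Fin (n + 1) → M) (η : Fin (n + 1) → ℕ) : M :=
  ∏ x, α x ^ η x

section CommMonoid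

variable {M : Type*} [CommMonoid M]

theorem heightChar_add (α : Fin (n + 1) → M) (η ξ : Fin (n + 1) → ℕ) :
    heightChar α (η + ξ) = heightChar α η * heightChar α ξ := by
  simp only [heightChar, Pi.add_apply, pow_add, Finset.prod_mul_distrib]

theorem heightChar_mul (α β : Fin (n + 1) → M) (η : Fin (n + 1) → ℕ) :
    heightChar (α * β) η = heightChar α η * heightChar β η := by
  simp only [heightChar, Pi.mul_apply, mul_pow, Finset.prod_mul_distrib]

theorem heightChar_mulSingle (x : Fin (n + 1)) (c : M) (η : Fin (n + 1) → ℕ) :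
    heightChar (Pi.mulSingle x c) η = c ^ η x := by
  rw [heightChar, Finset.prod_eq_single x]
  · rw [Pi.mulSingle_eq_same]
  · intro y _ hy
    rw [Pi.mulSingle_eq_of_ne hy, one_pow]
  · simp

theorem heightChar_single (α : Fin (n + 1) → M) (x : Fin (n + 1)) (k : ℕ) :
    heightChar α (Pi.single x k) = α x ^ k := by
  rw [heightChar, Finset.prod_eq_single x]
  · rw [Pi.single_eq_same]
  · intro y _ hy
    rw [Pi.single_eq_of_ne hy, pow_zero]
  · simp

/-- For each site `x`, the particles sent out by a toppling of `x` have the same total `α`-value as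
the two particles removed. The associated character `heightChar α` is preserved by all legal
topplings. -/
def IsTopplingInvariant (ζ : Fin (n + 1) → Label) (α : Fin (n + 1) → M) : Prop :=
  ∀ x, heightChar α (fun y => (ζ x).sent (y - x)) = α x ^ 2

variable {ζ : Fin (n + 1) → Label} {α : Fin (n + 1) → M} {η ξ : Fin (n + 1) → ℕ}

theorem IsTopplingInvariant.heightChar_topple (hα : IsTopplingInvariant ζ α) {x : Fin (n + 1)}
    (hx : 2 ≤ η x) : heightChar α (topple ζ η x) = heightChar α η := by
  set rest : Fin (n + 1) → ℕ := fun y => η y - if y = x then 2 else 0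
  have hη : rest + Pi.single x 2 = η := by
    funext y
    simpa only [Pi.add_apply, Pi.single_apply] using sub_add_of_two_le hx y
  calc heightChar α (topple ζ η x)
      = heightChar α rest * heightChar α (fun y => (ζ x).sent (y - x)) := heightChar_add _ _ _
    _ = heightChar α rest * heightChar α (Pi.single x 2) := by rw [hα x, heightChar_single]
    _ = heightChar α η := by rw [← heightChar_add, hη]

theorem IsTopplingInvariant.heightChar_of_stabilizesTo (hα : IsTopplingInvariant ζ α)
    (h : StabilizesTo ζ η ξ) : heightChar α ξ = heightChar α η := by
  obtain ⟨hreach, -⟩ := h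
  induction hreach with
  | refl => rfl
  | tail _ htopple ih =>
    obtain ⟨x, hx, rfl⟩ := htopple
    rw [hα.heightChar_topple hx, ih]

theorem IsTopplingInvariant.heightChar_drivenConfig (hζ : ∀ x, ζ x ≠ Label.l)
    (hα : IsTopplingInvariant ζ α) (η : Fin (n + 1) → ℕ) :
    ∀ {t : ℕ} (a : Fin t → Fin (n + 1)),
      heightChar α (drivenConfig ζ η t a) = heightChar α η * ∏ i, α (a i)
  | 0, _ => by simp [drivenConfig]
  | t + 1, a => by
    rw [hα.heightChar_of_stabilizesTo (stabilizesTo_drivenConfig_succ hζ η a), heightChar_add,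
      hα.heightChar_drivenConfig hζ η, heightChar_single, pow_one, Fin.prod_univ_castSucc,
      mul_assoc]

theorem isTopplingInvariant_of_sq_eq_one (hζ : ∀ x, ζ x ≠ Label.l)
    (hα : ∀ y, α y ^ 2 = 1)
    (hs : ∀ x, ζ x = Label.s → heightChar α (fun y => Label.s.sent (y - x)) = 1) :
    IsTopplingInvariant ζ α := by
  intro x
  rw [hα]
  cases hx : ζ x with
  | l => exact absurd hx (hζ x)
  | r =>
    refine Finset.prod_eq_one fun y _ => ?_
    simp only [Label.sent]
    split_ifs
    exacts [hα y, pow_zero _]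
  | s => exact hs x hx

end CommMonoid

theorem norm_expect_lt_of_ne {ι : Type*} [Fintype ι] {f : ι → ℂ} {i j : ι}
    (hf : ∀ k, ‖f k‖ ≤ 1) (hij : f i ≠ f j) : ‖𝔼 k, f k‖ < 1 := by
  have : Nonempty ι := ⟨i⟩
  have hcard : (Fintype.card ι : ℝ) ≠ 0 := by simp
  have hmem := (strictConvex_closedBall ℝ (0 : ℂ) 1).sum_mem_interior (t := Finset.univ)
    (w := fun _ => (Fintype.card ι : ℝ)⁻¹) (z := f) (fun _ _ => by positivity) (by simp)
    (Finset.mem_univ i) (Finset.mem_univ j) hij (inv_ne_zero hcard) (inv_ne_zero hcard)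
    (fun k _ => by simpa using hf k)
  rw [interior_closedBall _ one_ne_zero, mem_ball_zero_iff, ← Finset.smul_sum] at hmem
  rwa [Fintype.expect_eq_sum_div_card, div_eq_inv_mul, ← Complex.ofReal_natCast,
    ← Complex.ofReal_inv, ← Complex.real_smul]

variable {ζ : Fin (n + 1) → Label} {α : Fin (n + 1) → ℂ}

theorem IsTopplingInvariant.expect_heightChar_drivenConfig (hζ : ∀ x, ζ x ≠ Label.l)
    (hα : IsTopplingInvariant ζ α) (η : Fin (n + 1) → ℕ) (t : ℕ) :
    𝔼 a, heightChar α (drivenConfig ζ η t a) = heightChar α η * (𝔼 x, α x) ^ t := by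
  simp only [hα.heightChar_drivenConfig hζ, ← Finset.mul_expect]
  rw [Finset.expect_pow, Fintype.piFinset_univ]

theorem IsTopplingInvariant.tendsto_expect_half_add_re (hζ : ∀ x, ζ x ≠ Label.l)
    (hα : IsTopplingInvariant ζ α) (hnorm : ∀ x, ‖α x‖ ≤ 1) {x y : Fin (n + 1)}
    (hxy : α x ≠ α y) (c : ℂ) (η : Fin (n + 1) → ℕ) :
    Tendsto (fun t => 𝔼 a, (1 / 2 + (c * heightChar α (drivenConfig ζ η t a)).re)) atTop
      (𝓝 (1 / 2)) := by
  have hpow : Tendsto (fun t : ℕ => c * (heightChar α η * (𝔼 x, α x) ^ t)) atTop (𝓝 0) := by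
    simpa using ((tendsto_pow_atTop_nhds_zero_of_norm_lt_one
      (norm_expect_lt_of_ne hnorm hxy)).const_mul (heightChar α η)).const_mul c
  have hmean : ∀ t : ℕ, 𝔼 a, (1 / 2 + (c * heightChar α (drivenConfig ζ η t a)).re) =
      1 / 2 + (c * (heightChar α η * (𝔼 x, α x) ^ t)).re := by
    intro t
    rw [Finset.expect_add_distrib, Fintype.expect_const, ← Complex.re_expect,
      ← Finset.mul_expect, hα.expect_heightChar_drivenConfig hζ]
  simp only [hmean]
  simpa using ((Complex.continuous_re.tendsto 0).comp hpow).const_add (1 / 2 : ℝ)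

end Characters

section Occupation

/-- Any two labels `s` are separated by at least two other labels. -/
def IsSparse {ι : Type*} [Preorder ι] [LocallyFiniteOrder ι] (ζ : ι → Label) : Prop :=
  ∀ ⦃x y⦄, x < y → ζ x = Label.s → ζ y = Label.s → 2 ≤ (Finset.Ioo x y).card

variable {n : ℕ} {ζ : Fin (n + 1) → Label} {η ξ : Fin (n + 1) → ℕ} {x y : Fin (n + 1)}

theorem isSparse_fin_iff :
    IsSparse ζ ↔ ∀ ⦃x y⦄, x < y → ζ x = Label.s → ζ y = Label.s → (x : ℕ) + 2 < y := by
  simp only [IsSparse, Fin.card_Ioo]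
  exact forall₂_congr fun x y => forall₃_congr fun _ _ _ => by omega

theorem one_le_of_stabilizesTo (hζ : ∀ x, ζ x ≠ Label.l) (hx : ζ x = Label.s)
    (hy : ζ y ≠ Label.s) (hxy : (y : ℕ) + 1 = x) (h : StabilizesTo ζ η ξ) (hη : 1 ≤ η y) :
    1 ≤ ξ y := by
  obtain ⟨hreach, hstable⟩ := h
  -- A toppling which empties `y` sends two particles to `x`, whose toppling refills `y`.
  suffices 1 ≤ ξ y ∨ 2 ≤ ξ x from this.resolve_right (by have := hstable x; omega)
  have hyr : ζ y = Label.r := by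
    cases h : ζ y with
    | l => exact absurd h (hζ y)
    | r => rfl
    | s => exact absurd h hy
  clear hstable
  induction hreach with
  | refl => exact Or.inl hη
  | tail _ htopple ih =>
    obtain ⟨z, -, rfl⟩ := htopple
    by_cases hzy : z = y
    · subst hzy
      simp only [topple, hyr, Label.sent, if_pos (show (x : ℤ) - z = 1 by omega)]
      omega
    · by_cases hzx : z = x
      · subst hzx
        simp only [topple, hx, Label.sent,
          if_pos (show (y : ℤ) - z = -1 ∨ (y : ℤ) - z = 1 by omega)]
        omega
      · simp only [topple, if_neg (Ne.symm hzy), if_neg (Ne.symm hzx)]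
        omega

theorem ne_of_drivenConfig_eq_zero (hζ : ∀ x, ζ x ≠ Label.l) (hx : ζ x = Label.s)
    (hy : ζ y ≠ Label.s) (hxy : (y : ℕ) + 1 = x) (η : Fin (n + 1) → ℕ) :
    ∀ {t : ℕ} {a : Fin t → Fin (n + 1)}, drivenConfig ζ η t a y = 0 → ∀ i, a i ≠ y
  | 0, _, _ => fun i => i.elim0
  | t + 1, a, hvacant => by
    have hbefore : ¬ 1 ≤ (drivenConfig ζ η t (fun i => a i.castSucc) +
        (Pi.single (a (Fin.last t)) 1 : Fin (n + 1) → ℕ)) y := fun h => by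
      have := one_le_of_stabilizesTo hζ hx hy hxy (stabilizesTo_drivenConfig_succ hζ η a) h
      omega
    rw [Pi.add_apply, Nat.not_le, Nat.lt_one_iff, Nat.add_eq_zero_iff] at hbefore
    refine Fin.lastCases ?_ (ne_of_drivenConfig_eq_zero hζ hx hy hxy η hbefore.1)
    intro hlast
    simp [hlast] at hbefore

theorem tendsto_expect_vacant (hζ : ∀ x, ζ x ≠ Label.l) (hx : ζ x = Label.s)
    (hy : ζ y ≠ Label.s) (hxy : (y : ℕ) + 1 = x) (η : Fin (n + 1) → ℕ) :
    Tendsto (fun t => 𝔼 a, if drivenConfig ζ η t a y = 0 then (1 : ℝ) else 0) atTop (𝓝 0) := by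
  set avoid : Fin (n + 1) → ℝ := fun z => if z = y then 0 else 1 with havoid
  have havoid_nonneg : ∀ z, 0 ≤ avoid z := fun z => by
    simp only [havoid]
    split_ifs <;> norm_num
  have hlt : 𝔼 z, avoid z < 1 := by
    rw [← Fintype.expect_one (ι := Fin (n + 1)) (M := ℝ)]
    refine Finset.expect_lt_expect (fun z _ => ?_) ⟨y, Finset.mem_univ y, by simp [havoid]⟩
    simp only [havoid]
    split_ifs <;> norm_num
  refine squeeze_zero (fun t => Finset.expect_nonneg fun a _ => by positivity) (fun t => ?_)
    (tendsto_pow_atTop_nhds_zero_of_lt_one (Finset.expect_nonneg fun z _ => havoid_nonneg z) hlt)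
  rw [Finset.expect_pow, Fintype.piFinset_univ]
  refine Finset.expect_le_expect fun a _ => ?_
  split_ifs with hvacant
  · have := ne_of_drivenConfig_eq_zero hζ hx hy hxy η hvacant
    simp [havoid, this]
  · exact Finset.prod_nonneg fun i _ => havoid_nonneg _

/-- The probability that the site `y` is occupied at time `t`, when the process is started from `η`
in the environment `ζ`. -/
noncomputable def occupationProb (ζ : Fin (n + 1) → Label) (η : Fin (n + 1) → ℕ)
    (y : Fin (n + 1)) (t : ℕ) : ℝ :=
  𝔼 a : Fin t → Fin (n + 1), if drivenConfig ζ η t a y = 1 then 1 else 0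

theorem tendsto_occupationProb_one (hζ : ∀ x, ζ x ≠ Label.l) (hη : IsStable η)
    (hx : ζ x = Label.s) (hy : ζ y ≠ Label.s) (hxy : (y : ℕ) + 1 = x) :
    Tendsto (occupationProb ζ η y) atTop (𝓝 1) := by
  have hcompl : occupationProb ζ η y =
      fun t => 1 - 𝔼 a, if drivenConfig ζ η t a y = 0 then (1 : ℝ) else 0 := by
    funext t
    rw [occupationProb, ← Fintype.expect_one (ι := Fin t → Fin (n + 1)) (M := ℝ),
      ← Finset.expect_sub_distrib]
    refine Finset.expect_congr rfl fun a _ => ?_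
    have := isStable_drivenConfig hζ hη a y
    interval_cases drivenConfig ζ η t a y <;> norm_num
  simpa only [hcompl, sub_zero] using (tendsto_expect_vacant hζ hx hy hxy η).const_sub 1

theorem norm_mulSingle_le_one {c : ℂ} (hc : ‖c‖ ≤ 1) (x y : Fin (n + 1)) :
    ‖(Pi.mulSingle x c : Fin (n + 1) → ℂ) y‖ ≤ 1 := by
  rw [Pi.mulSingle_apply]
  split_ifs
  exacts [hc, norm_one.le]

theorem tendsto_occupationProb_of_not_adjacent (hn : 1 ≤ n) (hζ : ∀ x, ζ x ≠ Label.l)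
    (hη : IsStable η) (hy : ∀ x, ζ x = Label.s → (x : ℕ) + 1 ≠ y ∧ (y : ℕ) + 1 ≠ x) :
    Tendsto (occupationProb ζ η y) atTop (𝓝 (1 / 2)) := by
  have : Nontrivial (Fin (n + 1)) := Fin.nontrivial_iff_two_le.2 (by omega)
  obtain ⟨z, hz⟩ := exists_ne y
  set α : Fin (n + 1) → ℂ := Pi.mulSingle y (-1) with hα
  have hinv : IsTopplingInvariant ζ α := by
    refine isTopplingInvariant_of_sq_eq_one hζ (fun z => ?_) fun x hx => ?_
    · rw [hα, Pi.mulSingle_apply]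
      split_ifs <;> norm_num
    · have := hy x hx
      rw [hα, heightChar_mulSingle, Label.sent, if_neg (by omega), pow_zero]
  refine (hinv.tendsto_expect_half_add_re hζ (norm_mulSingle_le_one (by simp) _) (x := y) (y := z)
    ?_ (-(1 / 2)) η).congr fun t => Finset.expect_congr rfl fun a _ => ?_
  · rw [hα, Pi.mulSingle_eq_same, Pi.mulSingle_eq_of_ne hz]
    norm_num
  · have := isStable_drivenConfig hζ hη a y
    rw [hα, heightChar_mulSingle]
    interval_cases drivenConfig ζ η t a y <;> norm_num

theorem norm_mulSingle_mul_mulSingle_le_one {c d : ℂ} (hc : ‖c‖ ≤ 1) (hd : ‖d‖ ≤ 1)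
    (x y z : Fin (n + 1)) :
    ‖((Pi.mulSingle x c : Fin (n + 1) → ℂ) * (Pi.mulSingle y d : Fin (n + 1) → ℂ)) z‖ ≤ 1 := by
  rw [Pi.mul_apply, norm_mul]
  exact mul_le_one₀ (norm_mulSingle_le_one hc _ _) (norm_nonneg _) (norm_mulSingle_le_one hd _ _)

theorem isTopplingInvariant_of_eq_zero (hζ : ∀ x, ζ x ≠ Label.l) (hsparse : IsSparse ζ)
    (hx : ζ x = Label.s) (hx0 : (x : ℕ) = 0) (hxy : (x : ℕ) + 1 = y) :
    IsTopplingInvariant ζ (Pi.mulSingle x Complex.I * Pi.mulSingle y (-1) : Fin (n + 1) → ℂ) := by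
  rw [isSparse_fin_iff] at hsparse
  have hne : x ≠ y := by rintro rfl; omega
  intro z
  rw [heightChar_mul, heightChar_mulSingle, heightChar_mulSingle, Pi.mul_apply]
  by_cases hzx : z = x
  · subst hzx
    rw [hx, Pi.mulSingle_eq_same, Pi.mulSingle_eq_of_ne hne]
    simp [Label.sent, ← hxy]
  · have hlt : x < z := by omega
    rw [Pi.mulSingle_eq_of_ne hzx, one_mul]
    cases hz : ζ z with
    | l => exact absurd hz (hζ z)
    | r =>
      simp only [Label.sent, if_neg (show (x : ℤ) - z ≠ 1 by omega), Pi.mulSingle_apply]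
      split_ifs <;> simp
    | s =>
      have := hsparse hlt hx hz
      rw [Pi.mulSingle_eq_of_ne (by rintro rfl; omega)]
      simp [Label.sent, show ¬((x : ℤ) - z = -1 ∨ (x : ℤ) - z = 1) by omega,
        show ¬((y : ℤ) - z = -1 ∨ (y : ℤ) - z = 1) by omega]

theorem tendsto_occupationProb_succ_of_eq_zero (hζ : ∀ x, ζ x ≠ Label.l) (hsparse : IsSparse ζ)
    (hη : IsStable η) (hx : ζ x = Label.s) (hx0 : (x : ℕ) = 0) (hxy : (x : ℕ) + 1 = y) :
    Tendsto (occupationProb ζ η y) atTop (𝓝 (1 / 2)) := by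
  have hne : x ≠ y := by rintro rfl; omega
  refine ((isTopplingInvariant_of_eq_zero hζ hsparse hx hx0 hxy).tendsto_expect_half_add_re hζ
    (norm_mulSingle_mul_mulSingle_le_one (by simp) (by simp) _ _) (x := x) (y := y) ?_
    (-(1 / 2) * (1 - Complex.I)) η).congr fun t => Finset.expect_congr rfl fun a _ => ?_
  · simp only [Pi.mul_apply, Pi.mulSingle_eq_same, Pi.mulSingle_eq_of_ne hne,
      Pi.mulSingle_eq_of_ne hne.symm]
    simp [Complex.ext_iff]
  · have hocc_x := isStable_drivenConfig hζ hη a x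
    have hocc_y := isStable_drivenConfig hζ hη a y
    rw [heightChar_mul, heightChar_mulSingle, heightChar_mulSingle]
    interval_cases drivenConfig ζ η t a x <;> interval_cases drivenConfig ζ η t a y <;> norm_num

theorem isTopplingInvariant_neighbors (hζ : ∀ x, ζ x ≠ Label.l) (hsparse : IsSparse ζ)
    {w : Fin (n + 1)} (hx : ζ x = Label.s) (hwx : (w : ℕ) + 1 = x) (hxy : (x : ℕ) + 1 = y) :
    IsTopplingInvariant ζ (Pi.mulSingle w (-1) * Pi.mulSingle y (-1) : Fin (n + 1) → ℂ) := by
  rw [isSparse_fin_iff] at hsparse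
  refine isTopplingInvariant_of_sq_eq_one hζ (fun z => ?_) fun z hz => ?_
  · simp only [Pi.mul_apply, Pi.mulSingle_apply]
    split_ifs <;> norm_num
  · rw [heightChar_mul, heightChar_mulSingle, heightChar_mulSingle]
    rcases lt_trichotomy x z with hlt | rfl | hlt
    · have := hsparse hlt hx hz
      simp [Label.sent, show ¬((w : ℤ) - z = -1 ∨ (w : ℤ) - z = 1) by omega,
        show ¬((y : ℤ) - z = -1 ∨ (y : ℤ) - z = 1) by omega]
    · simp [Label.sent, ← hwx, ← hxy]
    · have := hsparse hlt hz hx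
      simp [Label.sent, show ¬((w : ℤ) - z = -1 ∨ (w : ℤ) - z = 1) by omega,
        show ¬((y : ℤ) - z = -1 ∨ (y : ℤ) - z = 1) by omega]

theorem tendsto_occupationProb_succ_of_pos (hζ : ∀ x, ζ x ≠ Label.l) (hsparse : IsSparse ζ)
    (hη : IsStable η) {w : Fin (n + 1)} (hx : ζ x = Label.s) (hwx : (w : ℕ) + 1 = x)
    (hxy : (x : ℕ) + 1 = y) : Tendsto (occupationProb ζ η y) atTop (𝓝 (1 / 2)) := by
  have hw : ζ w ≠ Label.s := fun h => by
    have := isSparse_fin_iff.1 hsparse (Fin.lt_def.2 (by omega)) h hx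
    omega
  set α : Fin (n + 1) → ℂ := Pi.mulSingle w (-1) * Pi.mulSingle y (-1) with hα
  have hinv : IsTopplingInvariant ζ α := isTopplingInvariant_neighbors hζ hsparse hx hwx hxy
  have hwy : α w ≠ α x := by
    simp only [hα, Pi.mul_apply, Pi.mulSingle_eq_same,
      Pi.mulSingle_eq_of_ne (show w ≠ y by rintro rfl; omega),
      Pi.mulSingle_eq_of_ne (show x ≠ w by rintro rfl; omega),
      Pi.mulSingle_eq_of_ne (show x ≠ y by rintro rfl; omega)]
    norm_num
  refine tendsto_of_tendsto_of_dist (hinv.tendsto_expect_half_add_re hζ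
    (norm_mulSingle_mul_mulSingle_le_one (by simp) (by simp) _ _) hwy (1 / 2) η)
    (squeeze_zero (fun _ => dist_nonneg) (fun t => ?_) (tendsto_expect_vacant hζ hx hw hwx η))
  rw [occupationProb, Real.dist_eq, ← Finset.expect_sub_distrib]
  refine (Finset.abs_expect_le _ _).trans (Finset.expect_le_expect fun a _ => ?_)
  have hocc_w := isStable_drivenConfig hζ hη a w
  have hocc_y := isStable_drivenConfig hζ hη a y
  rw [hα, heightChar_mul, heightChar_mulSingle, heightChar_mulSingle]
  interval_cases drivenConfig ζ η t a w <;> interval_cases drivenConfig ζ η t a y <;> norm_num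

theorem tendsto_occupationProb_half (hn : 1 ≤ n) (hζ : ∀ x, ζ x ≠ Label.l) (hsparse : IsSparse ζ)
    (hη : IsStable η) (hy : ∀ x, ζ x = Label.s → (y : ℕ) + 1 ≠ x) :
    Tendsto (occupationProb ζ η y) atTop (𝓝 (1 / 2)) := by
  by_cases hleft : ∃ x, ζ x = Label.s ∧ (x : ℕ) + 1 = y
  · obtain ⟨x, hx, hxy⟩ := hleft
    rcases Nat.eq_zero_or_pos (x : ℕ) with hx0 | hpos
    · exact tendsto_occupationProb_succ_of_eq_zero hζ hsparse hη hx hx0 hxy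
    · exact tendsto_occupationProb_succ_of_pos (w := ⟨x - 1, by omega⟩) hζ hsparse hη hx
        (Nat.sub_add_cancel hpos) hxy
  · exact tendsto_occupationProb_of_not_adjacent hn hζ hη fun x hx =>
      ⟨fun h => hleft ⟨x, hx, h⟩, hy x hx⟩

theorem tendsto_sum_occupationProb (hn : 1 ≤ n) (hζ : ∀ x, ζ x ≠ Label.l) (hsparse : IsSparse ζ)
    (hη : IsStable η) :
    Tendsto (fun t => ∑ y, occupationProb ζ η y t) atTop
      (𝓝 (∑ i : Fin n, (if ζ i.succ = Label.s then 1 else 1 / 2) + 1 / 2)) := by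
  simp only [Fin.sum_univ_castSucc]
  refine (tendsto_finsetSum _ fun i _ => ?_).add
    (tendsto_occupationProb_half hn hζ hsparse hη fun x _ => by simp; omega)
  split_ifs with hi
  · refine tendsto_occupationProb_one hζ hη hi (fun h => ?_) (by simp)
    have := isSparse_fin_iff.1 hsparse i.castSucc_lt_succ h hi
    simp at this
  · refine tendsto_occupationProb_half hn hζ hsparse hη fun x hx hix => hi ?_
    rwa [show i.succ = x from Fin.ext (by simpa using hix)]

theorem expect_occupiedFraction (ζ : Fin (n + 1) → Label) (η : Fin (n + 1) → ℕ) (t : ℕ) :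
    𝔼 a, occupiedFraction (drivenConfig ζ η t a) =
      (∑ y, occupationProb ζ η y t) / (n + 1) := by
  simp only [occupiedFraction, occupationProb, ← Finset.expect_div, ← Finset.expect_sum_comm]
  simp

theorem tendsto_expect_occupiedFraction (hn : 1 ≤ n) (hζ : ∀ x, ζ x ≠ Label.l)
    (hsparse : IsSparse ζ) (hη : IsStable η) :
    Tendsto (fun t => 𝔼 a, occupiedFraction (drivenConfig ζ η t a)) atTop
      (𝓝 (1 / 2 + (Finset.univ.filter fun i : Fin n => ζ i.succ = Label.s).card /
        (2 * (n + 1)))) := by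
  simp only [expect_occupiedFraction]
  convert (tendsto_sum_occupationProb hn hζ hsparse hη).div_const ((n : ℝ) + 1) using 2
  have hsite : ∀ i : Fin n, (if ζ i.succ = Label.s then (1 : ℝ) else 1 / 2) =
      1 / 2 + 1 / 2 * if ζ i.succ = Label.s then 1 else 0 := fun i => by split_ifs <;> norm_num
  simp only [hsite, Finset.sum_add_distrib, ← Finset.mul_sum, Finset.sum_boole, Finset.sum_const,
    Finset.card_univ, Fintype.card_fin, nsmul_eq_mul]
  field_simp
  ring

end Occupation

section IntervalReflection

/-- The label seen in a mirror. -/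
def Label.flip : Label → Label
  | Label.l => Label.r
  | Label.r => Label.l
  | Label.s => Label.s

@[simp] theorem Label.flip_flip (a : Label) : a.flip.flip = a := by cases a <;> rfl

@[simp] theorem Label.flip_eq_s {a : Label} : a.flip = Label.s ↔ a = Label.s := by
  cases a <;> simp [Label.flip]

@[simp] theorem Label.flip_eq_l {a : Label} : a.flip = Label.l ↔ a = Label.r := by
  cases a <;> simp [Label.flip]

theorem Label.sent_flip (a : Label) (d : ℤ) : a.flip.sent d = a.sent (-d) := by
  cases a <;> simp only [Label.sent, Label.flip] <;> split_ifs <;> first | rfl | omega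

variable {n : ℕ}

/-- The mirror image of an environment on the interval `{0, …, n}`. -/
def reflectInterval (ζ : Fin (n + 1) → Label) : Fin (n + 1) → Label :=
  fun x => (ζ x.rev).flip

@[simp] theorem reflectInterval_reflectInterval (ζ : Fin (n + 1) → Label) :
    reflectInterval (reflectInterval ζ) = ζ := by
  funext x
  simp [reflectInterval]

theorem IsSparse.reflectInterval {ζ : Fin (n + 1) → Label} (h : IsSparse ζ) :
    IsSparse (reflectInterval ζ) := by
  intro x y hxy hx hy
  have := h (Fin.rev_lt_rev.2 hxy) (Label.flip_eq_s.1 hy) (Label.flip_eq_s.1 hx)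
  rw [Fin.card_Ioo, Fin.val_rev, Fin.val_rev] at this
  rw [Fin.card_Ioo]
  omega

theorem topple_reflectInterval (ζ : Fin (n + 1) → Label) (η : Fin (n + 1) → ℕ)
    (x : Fin (n + 1)) :
    topple (reflectInterval ζ) (η ∘ Fin.rev) x.rev = topple ζ η x ∘ Fin.rev := by
  funext y
  have hdiff : -((y : ℤ) - (x.rev : ℕ)) = (y.rev : ℕ) - (x : ℕ) := by
    simp only [Fin.val_rev]
    omega
  simp only [topple, reflectInterval, Function.comp_apply, Fin.rev_rev, Label.sent_flip,
    Fin.rev_eq_iff, hdiff]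

theorem StabilizesTo.reflectInterval {ζ : Fin (n + 1) → Label} {η ξ : Fin (n + 1) → ℕ}
    (h : StabilizesTo ζ η ξ) :
    StabilizesTo (reflectInterval ζ) (η ∘ Fin.rev) (ξ ∘ Fin.rev) := by
  refine ⟨h.1.lift (· ∘ Fin.rev) ?_, fun x => h.2 _⟩
  rintro a b ⟨x, hx, rfl⟩
  exact ⟨x.rev, by simpa using hx, (topple_reflectInterval ζ a x).symm⟩

theorem stabilizesTo_reflectInterval_iff {ζ : Fin (n + 1) → Label} {η ξ : Fin (n + 1) → ℕ} :
    StabilizesTo (reflectInterval ζ) (η ∘ Fin.rev) ξ ↔ StabilizesTo ζ η (ξ ∘ Fin.rev) := by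
  have hrev : ∀ ξ : Fin (n + 1) → ℕ, (ξ ∘ Fin.rev) ∘ Fin.rev = ξ := fun ξ => by
    funext x
    simp
  constructor <;> intro h <;> simpa [hrev] using h.reflectInterval

theorem stabilize_eq {ζ : Fin (n + 1) → Label} {η ξ : Fin (n + 1) → ℕ}
    (h : StabilizesTo ζ η ξ) : stabilize ζ η = ξ :=
  (stabilizesTo_stabilize ⟨ξ, h⟩).unique h

theorem stabilize_reflectInterval (ζ : Fin (n + 1) → Label) (η : Fin (n + 1) → ℕ) :
    stabilize (reflectInterval ζ) (η ∘ Fin.rev) = stabilize ζ η ∘ Fin.rev := by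
  by_cases h : ∃ ξ, StabilizesTo ζ η ξ
  · exact stabilize_eq (stabilizesTo_stabilize h).reflectInterval
  · have hreflect : ¬ ∃ ξ, StabilizesTo (reflectInterval ζ) (η ∘ Fin.rev) ξ :=
      fun ⟨_, hξ⟩ => h ⟨_, stabilizesTo_reflectInterval_iff.1 hξ⟩
    rw [stabilize, dif_neg hreflect, stabilize, dif_neg h]

theorem drivenConfig_reflectInterval (ζ : Fin (n + 1) → Label) (η : Fin (n + 1) → ℕ) :
    ∀ {t : ℕ} (a : Fin t → Fin (n + 1)),
      drivenConfig (reflectInterval ζ) (η ∘ Fin.rev) t (fun i => (a i).rev) =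
        drivenConfig ζ η t a ∘ Fin.rev
  | 0, _ => rfl
  | t + 1, a => by
    rw [drivenConfig, drivenConfig, ← stabilize_reflectInterval,
      drivenConfig_reflectInterval ζ η fun i => a i.castSucc]
    congr 1
    funext y
    simp only [Pi.add_apply, Function.comp_apply, Pi.single_apply, Fin.rev_eq_iff]

theorem occupiedFraction_comp_rev (η : Fin (n + 1) → ℕ) :
    occupiedFraction (η ∘ Fin.rev) = occupiedFraction η := by
  rw [occupiedFraction, occupiedFraction]
  congr 2
  exact Finset.card_equiv Fin.revPerm (by simp)

theorem expect_occupiedFraction_reflectInterval (ζ : Fin (n + 1) → Label)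
    (η : Fin (n + 1) → ℕ) (t : ℕ) :
    𝔼 a, occupiedFraction (drivenConfig (reflectInterval ζ) (η ∘ Fin.rev) t a) =
      𝔼 a, occupiedFraction (drivenConfig ζ η t a) := by
  symm
  refine Fintype.expect_equiv (Equiv.arrowCongr (Equiv.refl _) Fin.revPerm) _ _ fun a => ?_
  rw [← occupiedFraction_comp_rev, ← drivenConfig_reflectInterval]
  rfl

end IntervalReflection

section StationaryDensity

instance : Fintype Label where
  elems := {Label.l, Label.r, Label.s}
  complete a := by cases a <;> decide

instance : DiscreteMeasurableSpace Label := ⟨fun _ => trivial⟩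

theorem isSparse_int_iff {ζ : ℤ → Label} :
    IsSparse ζ ↔ ∀ ⦃x y⦄, x < y → ζ x = Label.s → ζ y = Label.s → x + 2 < y := by
  simp only [IsSparse, Int.card_Ioo]
  exact forall₂_congr fun x y => forall₃_congr fun _ _ _ => by omega

theorem IsSparse.restrict {ζ : ℤ → Label} (h : IsSparse ζ) (n : ℕ) :
    IsSparse fun x : Fin (n + 1) => ζ x := by
  rw [isSparse_int_iff] at h
  rw [isSparse_fin_iff]
  intro x y hxy hx hy
  have := h (x := x) (y := y) (by exact_mod_cast hxy) hx hy
  omega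

theorem measurableSet_label (x : ℤ) (a : Label) : MeasurableSet {ζ : ℤ → Label | ζ x = a} :=
  measurableSet_eq_fun (measurable_pi_apply x) measurable_const

variable {ν : Measure (ℤ → Label)}

theorem IsRestricted.ae_isSparse (h : IsRestricted ν) : ∀ᵐ ζ ∂ν, IsSparse ζ := by
  have hone : ∀ᵐ ζ ∂ν, ∀ x, ¬ (ζ x = Label.s ∧ ζ (x + 1) = Label.s) :=
    ae_all_iff.2 fun x => measure_eq_zero_iff_ae_notMem.1 (h x).1
  have htwo : ∀ᵐ ζ ∂ν, ∀ x, ¬ (ζ x = Label.s ∧ ζ (x + 2) = Label.s) :=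
    ae_all_iff.2 fun x => measure_eq_zero_iff_ae_notMem.1 (h x).2
  filter_upwards [hone, htwo] with ζ hone htwo
  rw [isSparse_int_iff]
  intro x y hxy hx hy
  by_contra hle
  obtain rfl | rfl : y = x + 1 ∨ y = x + 2 := by omega
  exacts [hone x ⟨hx, hy⟩, htwo x ⟨hx, hy⟩]

theorem measure_label_eq (hν : MeasurePreserving shift ν ν) (a : Label) (x : ℤ) :
    ν {ζ | ζ x = a} = ν {ζ | ζ 0 = a} := by
  have hstep : ∀ x : ℤ, ν {ζ | ζ (x + 1) = a} = ν {ζ | ζ x = a} := fun x =>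
    hν.measure_preimage (measurableSet_label x a).nullMeasurableSet
  induction x using Int.induction_on with
  | zero => rfl
  | succ i ih => rw [hstep, ih]
  | pred i ih => rw [← hstep, sub_add_cancel, ih]

theorem ae_ne_label (hν : MeasurePreserving shift ν ν) {a : Label} (h : ν {ζ | ζ 0 = a} = 0) :
    ∀ᵐ ζ ∂ν, ∀ x, ζ x ≠ a :=
  ae_all_iff.2 fun x => measure_eq_zero_iff_ae_notMem.1 ((measure_label_eq hν a x).trans h)

theorem occupiedFraction_mem_Icc {n : ℕ} (η : Fin (n + 1) → ℕ) :
    occupiedFraction η ∈ Set.Icc 0 1 := by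
  refine ⟨by unfold occupiedFraction; positivity, ?_⟩
  rw [occupiedFraction, div_le_one (by positivity)]
  exact_mod_cast (Finset.card_filter_le _ _).trans_eq (Finset.card_fin (n + 1))

theorem expectedDensity_eq_integral_expect (μ : Measure (ℕ → Fin 2)) (ν : Measure (ℤ → Label))
    (n t : ℕ) :
    expectedDensity μ ν n t = ∫ p : (ℕ → Fin 2) × (ℤ → Label),
      𝔼 a, occupiedFraction (drivenConfig (fun x : Fin (n + 1) => p.2 x)
        (fun x : Fin (n + 1) => (p.1 x : ℕ)) t a) ∂(μ.prod ν) := by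
  simp [expectedDensity, Fintype.expect_eq_sum_div_card]

theorem measurable_comp_restrict {n : ℕ}
    (F : (Fin (n + 1) → Fin 2) → (Fin (n + 1) → Label) → ℝ) :
    Measurable fun p : (ℕ → Fin 2) × (ℤ → Label) =>
      F (fun x => p.1 x) (fun x => p.2 x) := by
  have hF : Measurable (Function.uncurry F) := Measurable.of_discrete
  exact hF.comp ((by fun_prop : Measurable fun p : (ℕ → Fin 2) × (ℤ → Label) =>
    ((fun x : Fin (n + 1) => p.1 x), fun x : Fin (n + 1) => p.2 x)))

theorem integrable_indicator_label [IsFiniteMeasure ν] (a : Label) (x : ℤ) :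
    Integrable (fun ζ => if ζ x = a then (1 : ℝ) else 0) ν :=
  .of_bound (Measurable.ite (measurableSet_label x a) measurable_const
    measurable_const).aestronglyMeasurable 1 (ae_of_all _ fun ζ => by split_ifs <;> simp)

theorem integrable_card_label [IsFiniteMeasure ν] (a : Label) {ι : Type*} [Fintype ι]
    (c : ι → ℤ) : Integrable (fun ζ => ((Finset.univ.filter fun i => ζ (c i) = a).card : ℝ)) ν := by
  simp only [← Finset.sum_boole]
  exact integrable_finsetSum _ fun i _ => integrable_indicator_label a (c i)

theorem integral_card_label_eq [IsFiniteMeasure ν] (hν : MeasurePreserving shift ν ν) (a : Label)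
    {ι : Type*} [Fintype ι] (c : ι → ℤ) :
    ∫ ζ, ((Finset.univ.filter fun i => ζ (c i) = a).card : ℝ) ∂ν =
      Fintype.card ι * ν.real {ζ | ζ 0 = a} := by
  have hsite : ∀ x, ∫ ζ, (if ζ x = a then (1 : ℝ) else 0) ∂ν = ν.real {ζ | ζ 0 = a} := fun x => by
    rw [measureReal_def, ← measure_label_eq hν a x, ← measureReal_def,
      ← integral_indicator_one (measurableSet_label x a)]
    simp only [Set.indicator_apply, Set.mem_ofPred_eq, Pi.one_apply]
  simp only [← Finset.sum_boole]
  rw [integral_finsetSum _ fun i _ => integrable_indicator_label a (c i)]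
  simp only [hsite, Finset.sum_const, Finset.card_univ, nsmul_eq_mul]

theorem tendsto_expectedDensity [IsProbabilityMeasure ν] (hν : MeasurePreserving shift ν ν)
    (μ : Measure (ℕ → Fin 2)) [IsProbabilityMeasure μ] (n : ℕ) (c : Fin n → ℤ)
    (hlim : ∀ᵐ ζ ∂ν, ∀ η : Fin (n + 1) → ℕ, IsStable η →
      Tendsto (fun t => 𝔼 a, occupiedFraction (drivenConfig (fun x : Fin (n + 1) => ζ x) η t a))
        atTop (𝓝 (1 / 2 + (Finset.univ.filter fun i => ζ (c i) = Label.s).card /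
          (2 * (n + 1))))) :
    Tendsto (fun t => expectedDensity μ ν n t) atTop
      (𝓝 (1 / 2 + n * ν.real {ζ | ζ 0 = Label.s} / (2 * (n + 1)))) := by
  have hint : ∫ p : (ℕ → Fin 2) × (ℤ → Label), (1 / 2 +
      ((Finset.univ.filter fun i => p.2 (c i) = Label.s).card : ℝ) / (2 * (n + 1))) ∂(μ.prod ν) =
      1 / 2 + n * ν.real {ζ | ζ 0 = Label.s} / (2 * (n + 1)) := by
    rw [integral_fun_snd fun ζ : ℤ → Label => (1 / 2 : ℝ) +
      ((Finset.univ.filter fun i => ζ (c i) = Label.s).card : ℝ) / (2 * (n + 1)),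
      integral_add (integrable_const _) ((integrable_card_label Label.s c).div_const _),
      integral_const, integral_div (2 * ((n : ℝ) + 1)), integral_card_label_eq hν]
    simp
  rw [← hint]
  simp only [expectedDensity_eq_integral_expect]
  refine tendsto_integral_of_dominated_convergence (fun _ => 1)
    (fun t => (measurable_comp_restrict fun η ζ => 𝔼 a, occupiedFraction
      (drivenConfig ζ (fun x => (η x : ℕ)) t a)).aestronglyMeasurable)
    (integrable_const _) (fun t => ae_of_all _ fun p => ?_) ?_
  · rw [Real.norm_of_nonneg (Finset.expect_nonneg fun a _ => (occupiedFraction_mem_Icc _).1)]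
    exact Finset.expect_le Finset.univ_nonempty fun a _ => (occupiedFraction_mem_Icc _).2
  · filter_upwards [Measure.quasiMeasurePreserving_snd.ae hlim] with p hp
    exact hp _ fun x => Nat.lt_succ_iff.1 (p.1 x).isLt

theorem isStationaryDensity [IsProbabilityMeasure ν] (hν : MeasurePreserving shift ν ν)
    (hdir : IsDirected ν) (hres : IsRestricted ν) (μ : Measure (ℕ → Fin 2))
    [IsProbabilityMeasure μ] :
    IsStationaryDensity μ ν (1 / 2 + ν.real {ζ | ζ 0 = Label.s} / 2) := by
  refine ⟨fun n => 1 / 2 + n * ν.real {ζ | ζ 0 = Label.s} / (2 * (n + 1)), fun n hn => ?_, ?_⟩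
  · rcases hdir with hr | hl
    · refine tendsto_expectedDensity hν μ n (fun i => (i.succ.rev : ℕ)) ?_
      filter_upwards [ae_ne_label hν hr, hres.ae_isSparse] with ζ hne hsparse η hη
      have hreflect := tendsto_expect_occupiedFraction hn
        (fun x => by simpa [reflectInterval] using hne _) (hsparse.restrict n).reflectInterval
        (η := η ∘ Fin.rev) fun x => hη _
      simpa only [expect_occupiedFraction_reflectInterval, reflectInterval, Label.flip_eq_s]
        using hreflect
    · refine tendsto_expectedDensity hν μ n (fun i => (i.succ : ℕ)) ?_
      filter_upwards [ae_ne_label hν hl, hres.ae_isSparse] with ζ hne hsparse η hη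
      exact tendsto_expect_occupiedFraction hn (fun x => hne _) (hsparse.restrict n) hη
  · have := (tendsto_natCast_div_add_atTop (𝕜 := ℝ) 1).const_mul (ν.real {ζ | ζ 0 = Label.s} / 2)
    rw [mul_one] at this
    refine (this.const_add (1 / 2)).congr fun n => ?_
    field_simp

end StationaryDensity

section LeastAction

theorem eventually_eq_ciSup {f : ℕ → ℕ} (hmono : Monotone f) (hbdd : BddAbove (Set.range f)) :
    ∀ᶠ N in atTop, f N = ⨆ N, f N := by
  have hlim := tendsto_atTop_ciSup hmono hbdd
  rwa [nhds_discrete, tendsto_pure] at hlim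

variable {η : ℤ → ℕ} {ζ : ℤ → Label}

/-- The odometer of the parallel dynamics: the number of topplings of `x` before time `t`. -/
def odometer (η : ℤ → ℕ) (ζ : ℤ → Label) (t : ℕ) (x : ℤ) : ℕ :=
  ((Finset.range t).filter fun k => 2 ≤ ((parallelStep ζ)^[k] η) x).card

theorem odometer_succ (η : ℤ → ℕ) (ζ : ℤ → Label) (t : ℕ) (x : ℤ) :
    odometer η ζ (t + 1) x =
      odometer η ζ t x + if 2 ≤ ((parallelStep ζ)^[t] η) x then 1 else 0 := by
  rw [odometer, Finset.range_add_one, Finset.filter_insert]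
  split_ifs
  · rw [Finset.card_insert_of_notMem (by simp), odometer]
  · rw [odometer, add_zero]

theorem monotone_odometer (η : ℤ → ℕ) (ζ : ℤ → Label) (x : ℤ) :
    Monotone fun t => odometer η ζ t x :=
  monotone_nat_of_le_succ fun t => odometer_succ η ζ t x ▸ Nat.le_add_right _ _

theorem iterate_parallelStep_add (η : ℤ → ℕ) (ζ : ℤ → Label) (t : ℕ) (x : ℤ) :
    ((parallelStep ζ)^[t] η) x + 2 * odometer η ζ t x =
      η x + odometer η ζ t (x - 1) * (ζ (x - 1)).sent 1 +
        odometer η ζ t (x + 1) * (ζ (x + 1)).sent (-1) := by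
  induction t with
  | zero => simp [odometer]
  | succ t ih =>
    simp only [odometer_succ, Function.iterate_succ_apply', parallelStep, add_mul, ite_mul, one_mul,
      zero_mul]
    split_ifs <;> omega

/-- Toppling every site `x` exactly `v x` times, legally or not, leaves heights at most `1`. The
heights are moved to the side of the losses, so that no subtraction of naturals occurs. -/
def IsSuperOdometer (η : ℤ → ℕ) (ζ : ℤ → Label) (v : ℤ → ℕ) : Prop :=
  ∀ x, η x + v (x - 1) * (ζ (x - 1)).sent 1 + v (x + 1) * (ζ (x + 1)).sent (-1) ≤ 2 * v x + 1

theorem IsSuperOdometer.odometer_le {v : ℤ → ℕ} (h : IsSuperOdometer η ζ v) (t : ℕ) :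
    ∀ x, odometer η ζ t x ≤ v x := by
  induction t with
  | zero => intro x; simp [odometer]
  | succ t ih =>
    intro x
    rw [odometer_succ]
    split_ifs with hx
    · have hheight := iterate_parallelStep_add η ζ t x
      have hsuper := h x
      have hleft := Nat.mul_le_mul_right ((ζ (x - 1)).sent 1) (ih (x - 1))
      have hright := Nat.mul_le_mul_right ((ζ (x + 1)).sent (-1)) (ih (x + 1))
      have := ih x
      omega
    · exact ih x

theorem stabilizable_iff_bddAbove_odometer :
    Stabilizable η ζ ↔ ∀ x, BddAbove (Set.range fun t => odometer η ζ t x) := by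
  refine forall_congr' fun x => ⟨fun hfin => ⟨hfin.toFinset.card, ?_⟩, fun ⟨K, hK⟩ => ?_⟩
  · rintro _ ⟨t, rfl⟩
    exact Finset.card_le_card fun k hk => hfin.mem_toFinset.2 (Finset.mem_filter.1 hk).2
  · by_contra hinf
    obtain ⟨S, hS, hcard⟩ := Set.Infinite.exists_subset_card_eq hinf (K + 1)
    have hle : S.card ≤ odometer η ζ (S.sup id + 1) x := Finset.card_le_card fun k hk =>
      Finset.mem_filter.2
        ⟨Finset.mem_range.2 (Nat.lt_succ_of_le (Finset.le_sup (f := id) hk)), hS hk⟩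
    have := hK ⟨S.sup id + 1, rfl⟩
    dsimp only at this
    omega

theorem Stabilizable.isSuperOdometer (h : Stabilizable η ζ) :
    IsSuperOdometer η ζ fun x => ⨆ t, odometer η ζ t x := by
  intro x
  have hfinal : ∀ x, ∀ᶠ t in atTop, odometer η ζ t x = ⨆ t, odometer η ζ t x := fun x =>
    eventually_eq_ciSup (monotone_odometer η ζ x) (stabilizable_iff_bddAbove_odometer.1 h x)
  have hstable : ∀ᶠ t in atTop, ¬ 2 ≤ ((parallelStep ζ)^[t] η) x :=
    Nat.cofinite_eq_atTop ▸ (h x).eventually_cofinite_notMem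
  obtain ⟨t, hself, hleft, hright, hle⟩ :=
    ((hfinal x).and ((hfinal (x - 1)).and ((hfinal (x + 1)).and hstable))).exists
  have := iterate_parallelStep_add η ζ t x
  rw [hself, hleft, hright] at this
  dsimp only
  omega

theorem stabilizable_iff_exists_isSuperOdometer :
    Stabilizable η ζ ↔ ∃ v, IsSuperOdometer η ζ v :=
  ⟨fun h => ⟨_, h.isSuperOdometer⟩, fun ⟨v, hv⟩ => stabilizable_iff_bddAbove_odometer.2 fun x =>
    ⟨v x, Set.forall_mem_range.2 fun t => hv.odometer_le t x⟩⟩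

/-- The mirror image of an environment on `ℤ`. -/
def reflectEnv (ζ : ℤ → Label) : ℤ → Label := fun x => (ζ (-x)).flip

@[simp] theorem reflectEnv_reflectEnv (ζ : ℤ → Label) : reflectEnv (reflectEnv ζ) = ζ := by
  funext x
  simp [reflectEnv]

theorem Stabilizable.reflectEnv (h : Stabilizable η ζ) :
    Stabilizable (fun x => η (-x)) (reflectEnv ζ) := by
  rw [stabilizable_iff_exists_isSuperOdometer] at h ⊢
  obtain ⟨v, hv⟩ := h
  refine ⟨fun x => v (-x), fun x => ?_⟩
  have := hv (-x)
  simp only [Sandpile.reflectEnv, Label.sent_flip, neg_neg]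
  rw [show -(x - 1) = -x + 1 by ring, show -(x + 1) = -x - 1 by ring]
  omega

theorem stabilizable_reflectEnv_iff :
    Stabilizable (fun x => η (-x)) (reflectEnv ζ) ↔ Stabilizable η ζ :=
  ⟨fun h => by simpa using h.reflectEnv, Stabilizable.reflectEnv⟩

end LeastAction

section Queue

variable {η : ℤ → ℕ} {ζ : ℤ → Label}

theorem Label.sent_r_one : Label.r.sent 1 = 2 := rfl

theorem Label.sent_r_neg_one : Label.r.sent (-1) = 0 := rfl

theorem Label.sent_s_one : Label.s.sent 1 = 1 := rfl

theorem Label.sent_s_neg_one : Label.s.sent (-1) = 1 := rfl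

theorem Label.eq_r_of_ne : ∀ {a : Label}, a ≠ Label.l → a ≠ Label.s → a = Label.r
  | Label.l, h, _ => absurd rfl h
  | Label.r, _, _ => rfl
  | Label.s, _, h => absurd rfl h

theorem IsSparse.eq_r (hζ : IsSparse ζ) (hl : ∀ x, ζ x ≠ Label.l) {x : ℤ} (hx : ζ x = Label.s)
    (y : ℤ) (hne : y ≠ x := by omega) (hlower : x - 2 ≤ y := by omega)
    (hupper : y ≤ x + 2 := by omega) : ζ y = Label.r := by
  rw [isSparse_int_iff] at hζ
  refine Label.eq_r_of_ne (hl y) fun hy => ?_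
  rcases hne.lt_or_gt with h | h
  · have := hζ h hy hx
    omega
  · have := hζ h hx hy
    omega

/-- Whether the site `x` removes a pair of particles: it has label `s`, and the heights of both
neighbours are even. -/
def service (η : ℤ → ℕ) (ζ : ℤ → Label) (x : ℤ) : ℕ :=
  if ζ x = Label.s ∧ Even (η (x - 1)) ∧ Even (η (x + 1)) then 1 else 0

theorem service_of_ne {x : ℤ} (hx : ζ x ≠ Label.s) : service η ζ x = 0 :=
  if_neg fun h => hx h.1

/-- The number of pairs of particles which leave `x` to the right when the pairs start at the sites
`x - N + 1, …, x`. The truncated subtraction is intended: a service without a pair is lost. -/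
def queue (η : ℤ → ℕ) (ζ : ℤ → Label) : ℕ → ℤ → ℕ
  | 0, _ => 0
  | N + 1, x => queue η ζ N (x - 1) + η x / 2 - service η ζ x

theorem queue_le_queue_succ (η : ℤ → ℕ) (ζ : ℤ → Label) (N : ℕ) :
    ∀ x, queue η ζ N x ≤ queue η ζ (N + 1) x := by
  induction N with
  | zero => exact fun x => Nat.zero_le _
  | succ N ih => exact fun x => Nat.sub_le_sub_right (Nat.add_le_add_right (ih (x - 1)) _) _

theorem monotone_queue (η : ℤ → ℕ) (ζ : ℤ → Label) (x : ℤ) :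
    Monotone fun N => queue η ζ N x :=
  monotone_nat_of_le_succ fun N => queue_le_queue_succ η ζ N x

theorem queue_le {W : ℤ → ℕ} (hW : ∀ x, W (x - 1) + η x / 2 - service η ζ x ≤ W x) (N : ℕ) :
    ∀ x, queue η ζ N x ≤ W x := by
  induction N with
  | zero => exact fun x => Nat.zero_le _
  | succ N ih => exact fun x =>
      (Nat.sub_le_sub_right (Nat.add_le_add_right (ih (x - 1)) _) _).trans (hW x)

/-- The bound on the queue given by a super-odometer `u`. Away from the labels `s`, every toppling
sends one pair to the right. At a label `s` and at its left neighbour, the pairs which bounce back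
must not be counted, and the bound is computed from the site to the left of both. -/
def queueBound (η : ℤ → ℕ) (ζ : ℤ → Label) (u : ℤ → ℕ) (y : ℤ) : ℕ :=
  if ζ y = Label.s then u (y - 2) + η (y - 1) / 2 + η y / 2 - service η ζ y
  else if ζ (y + 1) = Label.s then u (y - 1) + η y / 2 else u y

theorem IsSuperOdometer.le_of_eq_s {u : ℤ → ℕ} (hu : IsSuperOdometer η ζ u)
    (hl : ∀ x, ζ x ≠ Label.l) (hζ : IsSparse ζ) {x : ℤ} (hx : ζ x = Label.s) :
    u (x - 2) + η (x - 1) / 2 + η x / 2 - service η ζ x + η (x + 1) / 2 ≤ u (x + 1) := by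
  have hleft := hu (x - 1)
  have hself := hu x
  have hright := hu (x + 1)
  rw [show x - 1 - 1 = x - 2 by ring, sub_add_cancel, hx, hζ.eq_r hl hx (x - 2)] at hleft
  rw [hζ.eq_r hl hx (x - 1), hζ.eq_r hl hx (x + 1)] at hself
  rw [show x + 1 + 1 = x + 2 by ring, add_sub_cancel_right, hx, hζ.eq_r hl hx (x + 2)] at hright
  simp only [Label.sent_r_one, Label.sent_r_neg_one, Label.sent_s_one, Label.sent_s_neg_one]
    at hleft hself hright
  simp only [service, hx, true_and, Nat.even_iff]
  split_ifs <;> omega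

theorem IsSuperOdometer.queueBound_sub_one_add_le {u : ℤ → ℕ} (hu : IsSuperOdometer η ζ u)
    (hl : ∀ x, ζ x ≠ Label.l) (hζ : IsSparse ζ) (y : ℤ) :
    queueBound η ζ u (y - 1) + η y / 2 - service η ζ y ≤ queueBound η ζ u y := by
  by_cases hself : ζ y = Label.s
  · have hleft := hζ.eq_r hl hself (y - 1)
    simp [queueBound, hself, hleft, show y - 1 - 1 = y - 2 by ring]
  by_cases hright : ζ (y + 1) = Label.s
  · have hleft := hζ.eq_r hl hright (y - 1)
    simp [queueBound, hself, hright, hleft, service_of_ne]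
  by_cases hleft : ζ (y - 1) = Label.s
  · have := hu.le_of_eq_s hl hζ hleft
    rw [sub_add_cancel] at this
    simpa [queueBound, hself, hright, hleft, service_of_ne] using this
  · have := hu y
    rw [Label.eq_r_of_ne (hl _) hleft, Label.eq_r_of_ne (hl _) hright, Label.sent_r_one,
      Label.sent_r_neg_one] at this
    simp only [queueBound, sub_add_cancel, hself, hleft, hright, if_false, service_of_ne hself]
    omega

/-- The number of topplings of a site `y` of label `s` reached by `Q (y - 1)` pairs from the left:
two per pair, except that the first toppling empties the left neighbour if its height is even. -/
def symmetricOdometer (η : ℤ → ℕ) (Q : ℤ → ℕ) (y : ℤ) : ℕ :=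
  2 * (Q (y - 1) + η y / 2) - if Even (η (y - 1)) then 1 else 0

/-- The super-odometer given by a stationary queue `Q`. Two topplings of a label `s` send one pair
back to its left neighbour. -/
def queueOdometer (η : ℤ → ℕ) (ζ : ℤ → Label) (Q : ℤ → ℕ) (y : ℤ) : ℕ :=
  if ζ y = Label.s then symmetricOdometer η Q y
  else if ζ (y + 1) = Label.s then Q (y - 1) + (η y + symmetricOdometer η Q (y + 1)) / 2 else Q y

theorem isSuperOdometer_queueOdometer (hl : ∀ x, ζ x ≠ Label.l) (hζ : IsSparse ζ) {Q : ℤ → ℕ}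
    (hQ : ∀ x, Q x = Q (x - 1) + η x / 2 - service η ζ x) :
    IsSuperOdometer η ζ (queueOdometer η ζ Q) := by
  intro y
  by_cases hself : ζ y = Label.s
  · have hleft := hζ.eq_r hl hself (y - 1)
    have hright := hζ.eq_r hl hself (y + 1)
    have hQleft := hQ (y - 1)
    rw [service_of_ne (by simp [hleft])] at hQleft
    simp only [queueOdometer, symmetricOdometer, hself, hleft, hright, sub_add_cancel, if_true,
      reduceCtorEq, if_false, Label.sent_r_one, Label.sent_r_neg_one, Nat.even_iff]
    split_ifs <;> omega
  by_cases hright : ζ (y + 1) = Label.s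
  · have hleft := hζ.eq_r hl hright (y - 1)
    simp only [queueOdometer, hself, hleft, hright, sub_add_cancel, if_true,
      reduceCtorEq, if_false, Label.sent_r_one, Label.sent_s_neg_one]
    omega
  have hQself := hQ y
  rw [service_of_ne hself] at hQself
  by_cases hleft : ζ (y - 1) = Label.s
  · have hQleft := hQ (y - 1)
    rw [Label.eq_r_of_ne (hl _) hright]
    simp only [queueOdometer, symmetricOdometer, service, hself, hleft, hright, sub_add_cancel,
      if_true, if_false, true_and, Label.sent_s_one, Label.sent_r_neg_one,
      Nat.even_iff] at hQleft ⊢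
    split_ifs at hQleft ⊢ <;> omega
  · rw [Label.eq_r_of_ne (hl _) hleft, Label.eq_r_of_ne (hl _) hright]
    simp only [queueOdometer, hself, hleft, hright, sub_add_cancel, if_false, Label.sent_r_one,
      Label.sent_r_neg_one]
    omega

theorem stabilizable_iff_bddAbove_queue (hl : ∀ x, ζ x ≠ Label.l) (hζ : IsSparse ζ) :
    Stabilizable η ζ ↔ ∀ x, BddAbove (Set.range fun N => queue η ζ N x) := by
  rw [stabilizable_iff_exists_isSuperOdometer]
  refine ⟨fun ⟨u, hu⟩ x => ⟨queueBound η ζ u x, Set.forall_mem_range.2 fun N =>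
    queue_le (hu.queueBound_sub_one_add_le hl hζ) N x⟩, fun hbdd =>
    ⟨_, isSuperOdometer_queueOdometer (Q := fun x => ⨆ N, queue η ζ N x) hl hζ fun x => ?_⟩⟩
  have hlim : ∀ x, ∀ᶠ N in atTop, queue η ζ N x = ⨆ N, queue η ζ N x := fun x =>
    eventually_eq_ciSup (monotone_queue η ζ x) (hbdd x)
  obtain ⟨N, hx, hpred⟩ := (((tendsto_add_atTop_nat 1).eventually (hlim x)).and
    (hlim (x - 1))).exists
  rw [← hx, ← hpred, queue]

end Queue

section StationaryQueue

variable {η : ℤ → ℕ} {ζ : ℤ → Label}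

/-- The length of the stationary queue, in which pairs have been arriving since time `-∞`. It may be
infinite, and takes values in `ℝ≥0∞` because it will be integrated. -/
noncomputable def queueSup (η : ℤ → ℕ) (ζ : ℤ → Label) (x : ℤ) : ℝ≥0∞ :=
  ⨆ N, (queue η ζ N x : ℝ≥0∞)

theorem service_le_one (η : ℤ → ℕ) (ζ : ℤ → Label) (x : ℤ) : service η ζ x ≤ 1 := by
  rw [service]
  split_ifs <;> norm_num

theorem queueSup_add_le (η : ℤ → ℕ) (ζ : ℤ → Label) (x : ℤ) :
    queueSup η ζ (x - 1) + (η x / 2 : ℕ) ≤ queueSup η ζ x + service η ζ x := by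
  rw [queueSup, ENNReal.iSup_add]
  refine iSup_le fun N => ?_
  calc (queue η ζ N (x - 1) : ℝ≥0∞) + (η x / 2 : ℕ)
      ≤ queue η ζ (N + 1) x + service η ζ x := by
        exact_mod_cast tsub_le_iff_right.1 le_rfl
    _ ≤ queueSup η ζ x + service η ζ x :=
        add_le_add_left (le_iSup (fun N => (queue η ζ N x : ℝ≥0∞)) (N + 1)) _

theorem queueSup_le_add (η : ℤ → ℕ) (ζ : ℤ → Label) (x : ℤ) :
    queueSup η ζ x ≤ queueSup η ζ (x - 1) + (η x / 2 : ℕ) := by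
  refine iSup_le fun N => ?_
  calc (queue η ζ N x : ℝ≥0∞) ≤ queue η ζ N (x - 1) + (η x / 2 : ℕ) := by
        exact_mod_cast (queue_le_queue_succ η ζ N x).trans (Nat.sub_le _ _)
    _ ≤ queueSup η ζ (x - 1) + (η x / 2 : ℕ) :=
        add_le_add_left (le_iSup (fun N => (queue η ζ N (x - 1) : ℝ≥0∞)) N) _

theorem queueSup_sub_one_eq_top_iff (η : ℤ → ℕ) (ζ : ℤ → Label) (x : ℤ) :
    queueSup η ζ (x - 1) = ⊤ ↔ queueSup η ζ x = ⊤ := by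
  constructor <;> intro h
  · simpa [h] using queueSup_add_le η ζ x
  · simpa [h] using queueSup_le_add η ζ x

theorem queueSup_eq_top_iff (η : ℤ → ℕ) (ζ : ℤ → Label) (x : ℤ) :
    queueSup η ζ x = ⊤ ↔ queueSup η ζ 0 = ⊤ := by
  induction x using Int.induction_on with
  | zero => rfl
  | succ i ih => rw [← ih, ← queueSup_sub_one_eq_top_iff η ζ (i + 1), add_sub_cancel_right]
  | pred i ih => rw [← ih, queueSup_sub_one_eq_top_iff]

theorem bddAbove_queue_iff (η : ℤ → ℕ) (ζ : ℤ → Label) (x : ℤ) :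
    BddAbove (Set.range fun N => queue η ζ N x) ↔ queueSup η ζ x ≠ ⊤ := by
  refine ⟨fun ⟨B, hB⟩ => ne_top_of_le_ne_top (ENNReal.natCast_ne_top B) (iSup_le fun N =>
    Nat.cast_le.2 (hB ⟨N, rfl⟩)), fun h => ?_⟩
  obtain ⟨B, hB⟩ := ENNReal.exists_nat_gt h
  exact ⟨B, Set.forall_mem_range.2 fun N => Nat.cast_le.1
    ((le_iSup (fun N => (queue η ζ N x : ℝ≥0∞)) N).trans hB.le)⟩

theorem stabilizable_iff_queueSup_ne_top (hl : ∀ x, ζ x ≠ Label.l) (hζ : IsSparse ζ) :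
    Stabilizable η ζ ↔ queueSup η ζ 0 ≠ ⊤ := by
  simp only [stabilizable_iff_bddAbove_queue hl hζ, bddAbove_queue_iff, ne_eq, queueSup_eq_top_iff,
    forall_const]

/-- The translation of height configurations, the counterpart of `shift`. -/
def shiftHeight (η : ℤ → ℕ) : ℤ → ℕ := fun x => η (x + 1)

theorem service_shift (η : ℤ → ℕ) (ζ : ℤ → Label) (x : ℤ) :
    service (shiftHeight η) (shift ζ) x = service η ζ (x + 1) := by
  simp only [service, shiftHeight, shift, sub_add_cancel, add_sub_cancel_right]

theorem queue_shift (η : ℤ → ℕ) (ζ : ℤ → Label) (N : ℕ) :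
    ∀ x, queue (shiftHeight η) (shift ζ) N x = queue η ζ N (x + 1) := by
  induction N with
  | zero => exact fun x => rfl
  | succ N ih =>
    intro x
    rw [queue, queue, ih, service_shift, shiftHeight, sub_add_cancel, add_sub_cancel_right]

theorem queueSup_shift (η : ℤ → ℕ) (ζ : ℤ → Label) (x : ℤ) :
    queueSup (shiftHeight η) (shift ζ) x = queueSup η ζ (x + 1) := by
  simp only [queueSup, queue_shift]

variable {Ω : Type*} [MeasurableSpace Ω] {H : Ω → ℤ → ℕ} {Z : Ω → ℤ → Label}

theorem measurable_service {x : ℤ} (hH : ∀ y ≤ x + 1, Measurable fun ω => H ω y)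
    (hZ : Measurable fun ω => Z ω x) : Measurable fun ω => service (H ω) (Z ω) x := by
  have hlocal : Measurable fun q : Label × ℕ × ℕ =>
      if q.1 = Label.s ∧ Even q.2.1 ∧ Even q.2.2 then 1 else 0 := Measurable.of_discrete
  exact hlocal.comp (hZ.prodMk ((hH (x - 1) (by omega)).prodMk (hH (x + 1) le_rfl)))

theorem measurable_queue (hZ : ∀ y, Measurable fun ω => Z ω y) (N : ℕ) {x : ℤ}
    (hH : ∀ y ≤ x + 1, Measurable fun ω => H ω y) :
    Measurable fun ω => queue (H ω) (Z ω) N x := by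
  induction N generalizing x with
  | zero => exact measurable_const
  | succ N ih =>
    have hlocal : Measurable fun q : ℕ × ℕ × ℕ => q.1 + q.2.1 / 2 - q.2.2 := Measurable.of_discrete
    exact hlocal.comp ((ih (x := x - 1) fun y hy => hH y (by omega)).prodMk
      ((hH x (by omega)).prodMk (measurable_service hH (hZ x))))

theorem measurable_queueSup (hZ : ∀ y, Measurable fun ω => Z ω y) {x : ℤ}
    (hH : ∀ y ≤ x + 1, Measurable fun ω => H ω y) :
    Measurable fun ω => queueSup (H ω) (Z ω) x :=
  Measurable.iSup fun N => Measurable.of_discrete.comp (measurable_queue hZ N hH)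

end StationaryQueue

section Rates

theorem min_add_min_tsub_le (x a K : ℝ≥0∞) : min x K + min a (K - x) ≤ min (x + a) K := by
  refine le_min (add_le_add (min_le_left _ _) (min_le_left _ _)) ?_
  rcases le_total x K with hle | hle
  · exact (add_le_add (min_le_left _ _) (min_le_right _ _)).trans_eq (add_tsub_cancel_of_le hle)
  · simp [tsub_eq_zero_of_le hle]

theorem iSup_min_natCast_tsub {x : ℝ≥0∞} (hx : x ≠ ⊤) (a : ℝ≥0∞) :
    ⨆ K : ℕ, min a ((K : ℝ≥0∞) - x) = a := by
  rw [← inf_iSup_eq, ← ENNReal.iSup_sub, ENNReal.iSup_natCast, ENNReal.top_sub hx, inf_top_eq]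

theorem lintegral_le_of_add_le_add {Ω : Type*} [MeasurableSpace Ω] {P : Measure Ω}
    [IsFiniteMeasure P] {X Y A R : Ω → ℝ≥0∞}
    (hXY : IdentDistrib X Y P P) (hA : AEMeasurable A P) (hX : ∀ᵐ ω ∂P, X ω ≠ ⊤)
    (h : ∀ᵐ ω ∂P, X ω + A ω ≤ Y ω + R ω) : ∫⁻ ω, A ω ∂P ≤ ∫⁻ ω, R ω ∂P := by
  have htrunc_eq : ∀ K : ℕ, ∫⁻ ω, min (Y ω) K ∂P = ∫⁻ ω, min (X ω) K ∂P := fun K =>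
    (hXY.comp (u := fun x : ℝ≥0∞ => min x (K : ℝ≥0∞)) (by fun_prop)).lintegral_eq.symm
  have htrunc : ∀ K : ℕ, ∫⁻ ω, min (A ω) (K - X ω) ∂P ≤ ∫⁻ ω, R ω ∂P := by
    intro K
    have hfinite : ∫⁻ ω, min (X ω) K ∂P ≠ ⊤ :=
      ne_top_of_le_ne_top (by simp [ENNReal.mul_eq_top])
        (lintegral_mono fun ω => min_le_right (X ω) (K : ℝ≥0∞))
    refine (ENNReal.add_le_add_iff_left hfinite).1 ?_
    calc ∫⁻ ω, min (X ω) K ∂P + ∫⁻ ω, min (A ω) (K - X ω) ∂P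
        = ∫⁻ ω, min (X ω) K + min (A ω) (K - X ω) ∂P :=
          (lintegral_add_left' (hXY.aemeasurable_fst.min aemeasurable_const) _).symm
      _ ≤ ∫⁻ ω, min (Y ω) K + R ω ∂P := by
          refine lintegral_mono_ae (h.mono fun ω hω => ?_)
          refine ((min_add_min_tsub_le _ _ _).trans (min_le_min_right _ hω)).trans ?_
          exact (min_le_min_left _ le_self_add).trans_eq (min_add _ _ _).symm
      _ = ∫⁻ ω, min (X ω) K ∂P + ∫⁻ ω, R ω ∂P := by
          rw [lintegral_add_left' (hXY.aemeasurable_snd.min aemeasurable_const),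
            htrunc_eq K]
  calc ∫⁻ ω, A ω ∂P = ∫⁻ ω, ⨆ K : ℕ, min (A ω) (K - X ω) ∂P :=
        lintegral_congr_ae (hX.mono fun ω hω => (iSup_min_natCast_tsub hω _).symm)
    _ = ⨆ K : ℕ, ∫⁻ ω, min (A ω) (K - X ω) ∂P :=
        lintegral_iSup' (fun K => hA.min (aemeasurable_const.sub hXY.aemeasurable_fst))
          (ae_of_all _ fun ω K L hKL => min_le_min_left _
            (tsub_le_tsub_right (Nat.cast_le.2 hKL) _))
    _ ≤ ∫⁻ ω, R ω ∂P := iSup_le htrunc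

theorem measurable_height (y : ℤ) : Measurable fun p : (ℤ → ℕ) × (ℤ → Label) => p.1 y := by
  fun_prop

theorem measurable_label (y : ℤ) : Measurable fun p : (ℤ → ℕ) × (ℤ → Label) => p.2 y := by
  fun_prop

/-- The joint translation of heights and environments. -/
def shiftState (p : (ℤ → ℕ) × (ℤ → Label)) : (ℤ → ℕ) × (ℤ → Label) :=
  (shiftHeight p.1, shift p.2)

theorem identDistrib_comp {α β : Type*} [MeasurableSpace α] [MeasurableSpace β] {μ : Measure α}
    {T : α → α} (hT : MeasurePreserving T μ μ) {f : α → β} (hf : Measurable f) :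
    IdentDistrib f (f ∘ T) μ μ where
  aemeasurable_fst := hf.aemeasurable
  aemeasurable_snd := (hf.comp hT.measurable).aemeasurable
  map_eq := by rw [← Measure.map_map hf hT.measurable, hT.map_eq]

variable {P : Measure ((ℤ → ℕ) × (ℤ → Label))} [IsFiniteMeasure P]

theorem lintegral_arrival_le_lintegral_service (hP : MeasurePreserving shiftState P P)
    (h : ∀ᵐ p ∂P, queueSup p.1 p.2 0 ≠ ⊤) :
    ∫⁻ p, ((p.1 0 / 2 : ℕ) : ℝ≥0∞) ∂P ≤ ∫⁻ p, (service p.1 p.2 0 : ℝ≥0∞) ∂P := by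
  have hident : IdentDistrib (fun p => queueSup p.1 p.2 (-1)) (fun p => queueSup p.1 p.2 0)
      P P := by
    have hshift := identDistrib_comp hP
      (measurable_queueSup measurable_label fun y (_ : y ≤ -1 + 1) => measurable_height y)
    simp only [Function.comp_def, shiftState, queueSup_shift] at hshift
    exact hshift
  have hA : Measurable fun p : (ℤ → ℕ) × (ℤ → Label) => ((p.1 0 / 2 : ℕ) : ℝ≥0∞) :=
    (Measurable.of_discrete (f := fun n : ℕ => ((n / 2 : ℕ) : ℝ≥0∞))).comp (measurable_height 0)
  exact lintegral_le_of_add_le_add hident hA.aemeasurable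
    (h.mono fun p => (queueSup_eq_top_iff p.1 p.2 (-1)).not.2)
    (ae_of_all _ fun p => queueSup_add_le p.1 p.2 0)

theorem lintegral_min_service_queue_le (hP : MeasurePreserving shiftState P P) (N : ℕ) :
    ∫⁻ p, ((min (service p.1 p.2 0) (queue p.1 p.2 N (-1)) : ℕ) : ℝ≥0∞) ∂P ≤
      ∫⁻ p, ((p.1 0 / 2 : ℕ) : ℝ≥0∞) ∂P := by
  have hqueue : ∀ x, Measurable fun p : (ℤ → ℕ) × (ℤ → Label) => queue p.1 p.2 N x := fun x =>
    measurable_queue measurable_label N fun y _ => measurable_height y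
  have hident : IdentDistrib (fun p => queue p.1 p.2 N (-1)) (fun p => queue p.1 p.2 N 0) P P := by
    simpa [Function.comp_def, shiftState, queue_shift] using
      identDistrib_comp hP (hqueue (-1))
  have hA : Measurable fun p : (ℤ → ℕ) × (ℤ → Label) =>
      ((min (service p.1 p.2 0) (queue p.1 p.2 N (-1)) : ℕ) : ℝ≥0∞) :=
    Measurable.of_discrete.comp ((measurable_service (fun y _ => measurable_height y)
      (measurable_label 0)).min (hqueue (-1)))
  refine lintegral_le_of_add_le_add
    (hident.symm.comp (Measurable.of_discrete (f := ((↑) : ℕ → ℝ≥0∞)))) hA.aemeasurable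
    (ae_of_all _ fun p => ENNReal.natCast_ne_top _) (ae_of_all _ fun p => ?_)
  have hle : queue p.1 p.2 N 0 + min (service p.1 p.2 0) (queue p.1 p.2 N (-1)) ≤
      queue p.1 p.2 N (-1) + p.1 0 / 2 := by
    have := queue_le_queue_succ p.1 p.2 N 0
    rw [queue, zero_sub] at this
    omega
  simpa only [Function.comp_apply, Nat.cast_add] using (Nat.cast_le (α := ℝ≥0∞)).2 hle

theorem lintegral_service_le_lintegral_arrival (hP : MeasurePreserving shiftState P P)
    (h : ∀ᵐ p ∂P, queueSup p.1 p.2 0 = ⊤) :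
    ∫⁻ p, (service p.1 p.2 0 : ℝ≥0∞) ∂P ≤ ∫⁻ p, ((p.1 0 / 2 : ℕ) : ℝ≥0∞) ∂P := by
  have hmeas : ∀ N, Measurable fun p : (ℤ → ℕ) × (ℤ → Label) =>
      ((min (service p.1 p.2 0) (queue p.1 p.2 N (-1)) : ℕ) : ℝ≥0∞) := fun N =>
    Measurable.of_discrete.comp ((measurable_service (fun y _ => measurable_height y)
      (measurable_label 0)).min
        (measurable_queue measurable_label N fun y _ => measurable_height y))
  calc ∫⁻ p, (service p.1 p.2 0 : ℝ≥0∞) ∂P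
      ≤ ∫⁻ p, ⨆ N, ((min (service p.1 p.2 0) (queue p.1 p.2 N (-1)) : ℕ) : ℝ≥0∞) ∂P := by
        refine lintegral_mono_ae (h.mono fun p hp => ?_)
        obtain ⟨N, hN⟩ : ∃ N, (1 : ℝ≥0∞) < queue p.1 p.2 N (-1) :=
          lt_iSup_iff.1 (ENNReal.one_lt_top.trans_eq ((queueSup_eq_top_iff _ _ (-1)).2 hp).symm)
        refine le_iSup_of_le N (Nat.cast_le.2 (le_min le_rfl ?_))
        exact (service_le_one _ _ _).trans (Nat.one_lt_cast.1 hN).le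
    _ = ⨆ N, ∫⁻ p, ((min (service p.1 p.2 0) (queue p.1 p.2 N (-1)) : ℕ) : ℝ≥0∞) ∂P :=
        lintegral_iSup hmeas fun N M hNM p =>
          Nat.cast_le.2 (min_le_min_left _ (monotone_queue p.1 p.2 (-1) hNM))
    _ ≤ ∫⁻ p, ((p.1 0 / 2 : ℕ) : ℝ≥0∞) ∂P := iSup_le (lintegral_min_service_queue_le hP)

end Rates

section ZeroOne

theorem measurableSet_limsup_queueSup_eq_top (ζ : ℤ → Label) :
    MeasurableSet[limsup (fun x => MeasurableSpace.comap (fun η : ℤ → ℕ => η x) ⊤) atBot]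
      {η | queueSup η ζ 0 = ⊤} := by
  rw [atBot_basis.limsup_eq_iInf_iSup]
  simp only [MeasurableSpace.measurableSet_iInf]
  intro i _
  have hset : {η | queueSup η ζ 0 = ⊤} = (fun η => queueSup η ζ (i - 1)) ⁻¹' {⊤} :=
    Set.ext fun η => (queueSup_eq_top_iff η ζ (i - 1)).symm
  rw [hset]
  refine @measurable_queueSup _ (_) id (fun _ => ζ) (fun _ => measurable_const) _
    (fun y hy => ?_) _ (measurableSet_singleton ⊤)
  exact (comap_measurable fun η : ℤ → ℕ => η y).mono
    (le_iSup₂_of_le y (Set.mem_Iic.2 (hy.trans_eq (sub_add_cancel i 1))) le_rfl) le_rfl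

variable (κ : Measure ℕ) [IsProbabilityMeasure κ]

theorem ae_queueSup_eq_top_or_ae_ne_top (ζ : ℤ → Label) :
    (∀ᵐ η ∂Measure.infinitePi fun _ : ℤ => κ, queueSup η ζ 0 = ⊤) ∨
      ∀ᵐ η ∂Measure.infinitePi fun _ : ℤ => κ, queueSup η ζ 0 ≠ ⊤ := by
  have hle : ∀ x : ℤ, MeasurableSpace.comap (fun η : ℤ → ℕ => η x) ⊤ ≤ MeasurableSpace.pi :=
    fun x => (measurable_pi_apply x).comap_le
  have htail := measurableSet_limsup_queueSup_eq_top ζ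
  rcases measure_zero_or_one_of_measurableSet_limsup_atBot hle
    (iIndepFun_infinitePi (P := fun _ : ℤ => κ) (X := fun _ η => η) (by fun_prop)) htail with h | h
  · exact Or.inr (measure_eq_zero_iff_ae_notMem.1 h)
  · have hmeas : MeasurableSet {η : ℤ → ℕ | queueSup η ζ 0 = ⊤} :=
      limsup_le_iSup.trans (iSup_le hle) _ htail
    exact Or.inl ((mem_ae_iff_prob_eq_one hmeas).2 h)

theorem measurePreserving_shiftHeight :
    MeasurePreserving shiftHeight (Measure.infinitePi fun _ : ℤ => κ)
      (Measure.infinitePi fun _ : ℤ => κ) where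
  measurable := measurable_pi_lambda _ fun x => measurable_pi_apply (x + 1)
  map_eq := Measure.map_infinitePi_infinitePi_of_inj (P := fun _ : ℤ => κ) (f := fun x : ℤ => x + 1)
    (add_left_injective 1)

theorem measurePreserving_shiftState {ν : Measure (ℤ → Label)} [SFinite ν]
    (hν : MeasurePreserving shift ν ν) :
    MeasurePreserving shiftState ((Measure.infinitePi fun _ : ℤ => κ).prod ν)
      ((Measure.infinitePi fun _ : ℤ => κ).prod ν) :=
  (measurePreserving_shiftHeight κ).prod hν

theorem ae_queueSup_shift_eq_top_iff (ζ : ℤ → Label) :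
    (∀ᵐ η ∂Measure.infinitePi fun _ : ℤ => κ, queueSup η (shift ζ) 0 = ⊤) ↔
      ∀ᵐ η ∂Measure.infinitePi fun _ : ℤ => κ, queueSup η ζ 0 = ⊤ := by
  have hpres := measurePreserving_shiftHeight κ
  have hmeas : MeasurableSet {η | queueSup η (shift ζ) 0 = ⊤} :=
    measurable_queueSup (H := id) (Z := fun _ => shift ζ) (fun _ => measurable_const)
      (fun y _ => measurable_pi_apply y) (measurableSet_singleton ⊤)
  have hmap := ae_map_iff hpres.aemeasurable hmeas
  rw [hpres.map_eq] at hmap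
  simp only [hmap, queueSup_shift, queueSup_eq_top_iff]

theorem ae_prod_queueSup_eq_top_or_ae_ne_top {ν : Measure (ℤ → Label)} [SFinite ν]
    (hν : Ergodic shift ν) :
    (∀ᵐ p ∂(Measure.infinitePi fun _ : ℤ => κ).prod ν, queueSup p.1 p.2 0 = ⊤) ∨
      ∀ᵐ p ∂(Measure.infinitePi fun _ : ℤ => κ).prod ν, queueSup p.1 p.2 0 ≠ ⊤ := by
  have htop : MeasurableSet {p : (ℤ → ℕ) × (ℤ → Label) | queueSup p.1 p.2 0 = ⊤} :=
    measurable_queueSup measurable_label (fun y _ => measurable_height y)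
      (measurableSet_singleton ⊤)
  have hfiber : MeasurableSet
      {ζ : ℤ → Label | ∀ᵐ η ∂Measure.infinitePi fun _ : ℤ => κ, queueSup η ζ 0 = ⊤} :=
    measurable_measure_prodMk_right htop.compl (measurableSet_singleton 0)
  refine (hν.toPreErgodic.ae_mem_or_ae_notMem hfiber
    (Set.ext fun ζ => ae_queueSup_shift_eq_top_iff κ ζ)).imp (fun h => ?_) fun h => ?_
  · rwa [Measure.ae_prod_iff_ae_ae htop, Measure.ae_ae_comm htop]
  · refine (Measure.ae_prod_iff_ae_ae htop.compl).2 ((Measure.ae_ae_comm htop.compl).2 ?_)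
    exact h.mono fun ζ hζ => (ae_queueSup_eq_top_or_ae_ne_top κ ζ).resolve_left hζ

end ZeroOne

section Poisson

theorem lintegral_poissonMeasure_of_hasSum {r : ℝ≥0} {f : ℕ → ℝ} (hf : ∀ n, 0 ≤ f n) {a : ℝ}
    (h : HasSum (fun n : ℕ => Real.exp (-r) * r ^ n / n ! * f n) a) :
    ∫⁻ n, ENNReal.ofReal (f n) ∂poissonMeasure r = ENNReal.ofReal a := by
  simp only [poissonMeasure, lintegral_sum_measure, lintegral_smul_measure, lintegral_dirac,
    smul_eq_mul]
  rw [← h.tsum_eq, ENNReal.ofReal_tsum_of_nonneg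
    (fun n => mul_nonneg (by positivity) (hf n)) h.summable]
  exact tsum_congr fun n => (ENNReal.ofReal_mul (by positivity)).symm

theorem hasSum_poisson_neg_one_pow (r : ℝ≥0) :
    HasSum (fun n : ℕ => Real.exp (-r) * r ^ n / n ! * (-1) ^ n) (Real.exp (-2 * r)) := by
  have hexp := (NormedSpace.expSeries_div_hasSum_exp (-r : ℝ)).mul_left (Real.exp (-r))
  rw [← Real.exp_eq_exp_ℝ, ← Real.exp_add] at hexp
  convert! hexp using 1
  · funext n
    rw [neg_pow (r : ℝ) n]
    ring
  · congr 1
    ring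

theorem hasSum_poisson_natCast (r : ℝ≥0) :
    HasSum (fun n : ℕ => Real.exp (-r) * r ^ n / n ! * n) r := by
  rw [← hasSum_nat_add_iff' 1]
  convert! (hasSum_one_poissonMeasure r).mul_left (r : ℝ) using 1
  · funext n
    rw [Nat.factorial_succ]
    push_cast
    field_simp
    ring
  · simp

theorem natCast_div_two_eq (n : ℕ) :
    ((n / 2 : ℕ) : ℝ) = ((n : ℝ) - (1 - (-1) ^ n) / 2) / 2 := by
  rcases Nat.even_or_odd' n with ⟨k, rfl | rfl⟩
  · rw [Nat.mul_div_cancel_left k two_pos, pow_mul]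
    push_cast
    norm_num
  · rw [show (2 * k + 1) / 2 = k by omega, pow_succ, pow_mul]
    push_cast
    norm_num

theorem indicator_even_eq (n : ℕ) :
    {n : ℕ | Even n}.indicator (1 : ℕ → ℝ) n = (1 + (-1) ^ n) / 2 := by
  rcases Nat.even_or_odd n with hn | hn
  · simp [hn]
  · simp [hn, Nat.not_even_iff_odd.2 hn]

theorem lintegral_poissonMeasure_div_two (r : ℝ≥0) :
    ∫⁻ n, ((n / 2 : ℕ) : ℝ≥0∞) ∂poissonMeasure r =
      ENNReal.ofReal ((r - (1 - Real.exp (-2 * r)) / 2) / 2) := by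
  have hsum : HasSum (fun n : ℕ => Real.exp (-r) * r ^ n / n ! * ((n / 2 : ℕ) : ℝ))
      ((r - (1 - Real.exp (-2 * r)) / 2) / 2) := by
    convert! ((hasSum_poisson_natCast r).sub (((hasSum_one_poissonMeasure r).sub
      (hasSum_poisson_neg_one_pow r)).div_const 2)).div_const 2 using 1
    funext n
    rw [natCast_div_two_eq]
    ring
  simpa using lintegral_poissonMeasure_of_hasSum (fun n => Nat.cast_nonneg _) hsum

theorem poissonMeasure_setOf_even (r : ℝ≥0) :
    poissonMeasure r {n | Even n} = ENNReal.ofReal ((1 + Real.exp (-2 * r)) / 2) := by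
  have hsum : HasSum (fun n : ℕ => Real.exp (-r) * r ^ n / n ! * {n : ℕ | Even n}.indicator 1 n)
      ((1 + Real.exp (-2 * r)) / 2) := by
    convert! ((hasSum_one_poissonMeasure r).add (hasSum_poisson_neg_one_pow r)).div_const 2 using 1
    funext n
    rw [indicator_even_eq]
    ring
  rw [← lintegral_poissonMeasure_of_hasSum
      (fun n => Set.indicator_nonneg (fun _ _ => zero_le_one) n) hsum,
    ← lintegral_indicator_one MeasurableSet.of_discrete]
  refine lintegral_congr fun n => ?_
  by_cases hn : Even n <;> simp [hn]

instance (r : ℝ≥0) : IsProbabilityMeasure (poissonField r) := by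
  rw [poissonField]
  infer_instance

theorem measurePreserving_eval_poissonField (r : ℝ≥0) (x : ℤ) :
    MeasurePreserving (fun η : ℤ → ℕ => η x) (poissonField r) (poissonMeasure r) :=
  measurePreserving_eval_infinitePi (fun _ : ℤ => poissonMeasure r) x

variable (r : ℝ≥0) (ν : Measure (ℤ → Label))

theorem lintegral_arrival [IsProbabilityMeasure ν] :
    ∫⁻ p, ((p.1 0 / 2 : ℕ) : ℝ≥0∞) ∂(poissonField r).prod ν =
      ENNReal.ofReal ((r - (1 - Real.exp (-2 * r)) / 2) / 2) := by
  rw [← lintegral_poissonMeasure_div_two]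
  exact ((measurePreserving_eval_poissonField r 0).comp measurePreserving_fst).lintegral_comp
    (f := fun n : ℕ => ((n / 2 : ℕ) : ℝ≥0∞)) Measurable.of_discrete

theorem natCast_service_zero_eq_indicator (p : (ℤ → ℕ) × (ℤ → Label)) :
    (service p.1 p.2 0 : ℝ≥0∞) =
      ((Set.pi (({-1, 1} : Finset ℤ) : Set ℤ) fun _ => {n : ℕ | Even n}) ×ˢ
        {ζ : ℤ → Label | ζ 0 = Label.s}).indicator 1 p := by
  classical
  simp [service, Set.indicator_apply, and_comm]

theorem lintegral_service [IsFiniteMeasure ν] :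
    ∫⁻ p, (service p.1 p.2 0 : ℝ≥0∞) ∂(poissonField r).prod ν =
      ENNReal.ofReal (ν.real {ζ | ζ 0 = Label.s} * ((1 + Real.exp (-2 * r)) / 2) ^ 2) := by
  have heven : MeasurableSet (Set.pi (({-1, 1} : Finset ℤ) : Set ℤ) fun _ => {n : ℕ | Even n}) :=
    MeasurableSet.pi (Finset.countable_toSet _) fun _ _ => MeasurableSet.of_discrete
  simp only [natCast_service_zero_eq_indicator]
  rw [lintegral_indicator_one (heven.prod (measurableSet_label 0 Label.s)), Measure.prod_prod,
    poissonField, Measure.infinitePi_pi _ fun _ _ => MeasurableSet.of_discrete, Finset.prod_const,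
    Finset.card_pair (by decide), poissonMeasure_setOf_even, ENNReal.ofReal_mul measureReal_nonneg,
    ENNReal.ofReal_pow (by positivity), ofReal_measureReal, mul_comm]

end Poisson

section TransitionDensity

/-- The difference of the two sides of the equation for the transition density, when the label `s`
has density `f`. It is twice the excess of the arrival rate of pairs over their service rate. -/
noncomputable def transitionGap (f ρ : ℝ) : ℝ :=
  ρ - 1 / 2 * (1 - Real.exp (-2 * ρ)) - f / 2 * (1 + Real.exp (-2 * ρ)) ^ 2

theorem exp_neg_two_mul_sub_lt {x y : ℝ} (hx : 0 ≤ x) (hxy : x < y) :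
    Real.exp (-2 * x) - Real.exp (-2 * y) < 2 * (y - x) := by
  have hx1 : Real.exp (-2 * x) ≤ 1 := Real.exp_le_one_iff.2 (by linarith)
  have hxy1 : Real.exp (-2 * (y - x)) ≤ 1 := Real.exp_le_one_iff.2 (by linarith)
  calc Real.exp (-2 * x) - Real.exp (-2 * y)
      = Real.exp (-2 * x) * (1 - Real.exp (-2 * (y - x))) := by
        rw [mul_sub, ← Real.exp_add]
        ring_nf
    _ ≤ 1 - Real.exp (-2 * (y - x)) := mul_le_of_le_one_left (by linarith) hx1
    _ < 2 * (y - x) := by linarith [Real.add_one_lt_exp (x := -2 * (y - x)) (by linarith)]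

theorem strictMonoOn_transitionGap {f : ℝ} (hf : 0 ≤ f) :
    StrictMonoOn (transitionGap f) (Set.Ici 0) := by
  intro x hx y _ hxy
  have hexp : Real.exp (-2 * y) ≤ Real.exp (-2 * x) := Real.exp_le_exp.2 (by linarith)
  have hsquare : f / 2 * (1 + Real.exp (-2 * y)) ^ 2 ≤ f / 2 * (1 + Real.exp (-2 * x)) ^ 2 := by
    gcongr
  have hlinear := exp_neg_two_mul_sub_lt hx hxy
  simp only [transitionGap]
  linarith

theorem exists_transitionGap_eq_zero {f : ℝ} (hf : 0 ≤ f) :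
    ∃ ρ, 0 ≤ ρ ∧ transitionGap f ρ = 0 := by
  have hcont : Continuous (transitionGap f) := by
    unfold transitionGap
    fun_prop
  have hzero : transitionGap f 0 ≤ 0 := by
    norm_num [transitionGap]
    linarith
  have hright : 0 ≤ transitionGap f (1 / 2 + 2 * f) := by
    have hexp : Real.exp (-2 * (1 / 2 + 2 * f)) ≤ 1 := Real.exp_le_one_iff.2 (by linarith)
    have hsquare : f / 2 * (1 + Real.exp (-2 * (1 / 2 + 2 * f))) ^ 2 ≤ f / 2 * (1 + 1) ^ 2 := by
      gcongr
    rw [transitionGap]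
    linarith [Real.exp_pos (-2 * (1 / 2 + 2 * f))]
  obtain ⟨ρ, hρ, hgap⟩ := intermediate_value_Icc (by positivity) hcont.continuousOn ⟨hzero, hright⟩
  exact ⟨ρ, hρ.1, hgap⟩

theorem ae_poissonField_zero : ∀ᵐ η ∂poissonField 0, η = 0 := by
  have hzero : ∀ᵐ n ∂poissonMeasure 0, n = 0 := by
    refine (mem_ae_iff_prob_eq_one (measurableSet_singleton 0)).2 ?_
    simp [poissonMeasure_singleton]
  simp only [funext_iff, ae_all_iff]
  exact fun x => (measurePreserving_eval_poissonField 0 x).quasiMeasurePreserving.ae hzero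

theorem stabilizable_zero (ζ : ℤ → Label) : Stabilizable 0 ζ :=
  stabilizable_iff_exists_isSuperOdometer.2 ⟨0, fun x => by simp⟩

theorem zero_mem_stabilizingParameters (ν : Measure (ℤ → Label)) [SFinite ν] :
    (0 : ℝ) ∈ stabilizingParameters ν := by
  refine ⟨le_rfl, ?_⟩
  rw [Real.toNNReal_zero]
  filter_upwards [Measure.quasiMeasurePreserving_fst.ae ae_poissonField_zero] with p hp
  exact hp ▸ stabilizable_zero p.2

section Rates

variable (ν : Measure (ℤ → Label)) [IsProbabilityMeasure ν] {σ : ℝ}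

theorem lintegral_arrival_le_lintegral_service_iff (hσ : 0 ≤ σ) :
    ∫⁻ p, ((p.1 0 / 2 : ℕ) : ℝ≥0∞) ∂(poissonField σ.toNNReal).prod ν ≤
        ∫⁻ p, (service p.1 p.2 0 : ℝ≥0∞) ∂(poissonField σ.toNNReal).prod ν ↔
      transitionGap (ν.real {ζ | ζ 0 = Label.s}) σ ≤ 0 := by
  rw [lintegral_arrival, lintegral_service, ENNReal.ofReal_le_ofReal_iff (by positivity),
    Real.coe_toNNReal σ hσ, transitionGap]
  constructor <;> intro h <;> linarith

theorem lintegral_service_le_lintegral_arrival_iff (hσ : 0 ≤ σ) :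
    ∫⁻ p, (service p.1 p.2 0 : ℝ≥0∞) ∂(poissonField σ.toNNReal).prod ν ≤
        ∫⁻ p, ((p.1 0 / 2 : ℕ) : ℝ≥0∞) ∂(poissonField σ.toNNReal).prod ν ↔
      0 ≤ transitionGap (ν.real {ζ | ζ 0 = Label.s}) σ := by
  have harrival : 0 ≤ (σ - (1 - Real.exp (-2 * σ)) / 2) / 2 := by
    linarith [Real.add_one_le_exp (-2 * σ)]
  rw [lintegral_arrival, lintegral_service, Real.coe_toNNReal σ hσ,
    ENNReal.ofReal_le_ofReal_iff harrival, transitionGap]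
  constructor <;> intro h <;> linarith

end Rates

variable {ν : Measure (ℤ → Label)} [IsProbabilityMeasure ν] {σ ρ : ℝ}

theorem transitionGap_nonpos_of_mem_stabilizingParameters (hν : MeasurePreserving shift ν ν)
    (hl : ∀ᵐ ζ ∂ν, ∀ x, ζ x ≠ Label.l) (hs : ∀ᵐ ζ ∂ν, IsSparse ζ)
    (hσ : σ ∈ stabilizingParameters ν) : transitionGap (ν.real {ζ | ζ 0 = Label.s}) σ ≤ 0 := by
  refine (lintegral_arrival_le_lintegral_service_iff ν hσ.1).1
    (lintegral_arrival_le_lintegral_service (measurePreserving_shiftState _ hν) ?_)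
  filter_upwards [hσ.2, Measure.quasiMeasurePreserving_snd.ae (hl.and hs)] with p hp hgood
  exact (stabilizable_iff_queueSup_ne_top hgood.1 hgood.2).1 hp

theorem mem_stabilizingParameters_of_transitionGap_neg (hν : Ergodic shift ν)
    (hl : ∀ᵐ ζ ∂ν, ∀ x, ζ x ≠ Label.l) (hs : ∀ᵐ ζ ∂ν, IsSparse ζ) (hσ : 0 ≤ σ)
    (hgap : transitionGap (ν.real {ζ | ζ 0 = Label.s}) σ < 0) : σ ∈ stabilizingParameters ν := by
  have hfinite : ∀ᵐ p ∂(poissonField σ.toNNReal).prod ν, queueSup p.1 p.2 0 ≠ ⊤ := by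
    refine (ae_prod_queueSup_eq_top_or_ae_ne_top (poissonMeasure σ.toNNReal) hν).resolve_left
      fun htop => hgap.not_ge ?_
    exact (lintegral_service_le_lintegral_arrival_iff ν hσ).1
      (lintegral_service_le_lintegral_arrival
        (measurePreserving_shiftState _ hν.toMeasurePreserving) htop)
  refine ⟨hσ, ?_⟩
  filter_upwards [hfinite, Measure.quasiMeasurePreserving_snd.ae (hl.and hs)] with p hp hgood
  exact (stabilizable_iff_queueSup_ne_top hgood.1 hgood.2).2 hp

theorem isTransitionDensity_of_ae_ne_l (hν : Ergodic shift ν)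
    (hl : ∀ᵐ ζ ∂ν, ∀ x, ζ x ≠ Label.l) (hs : ∀ᵐ ζ ∂ν, IsSparse ζ) (hρ : 0 ≤ ρ)
    (hgap : transitionGap (ν.real {ζ | ζ 0 = Label.s}) ρ = 0) : IsTransitionDensity ν ρ := by
  have hmono := strictMonoOn_transitionGap (f := ν.real {ζ | ζ 0 = Label.s}) measureReal_nonneg
  constructor
  · intro σ hσ
    rw [← hmono.le_iff_le hσ.1 hρ, hgap]
    exact transitionGap_nonpos_of_mem_stabilizingParameters hν.toMeasurePreserving hl hs hσ
  · refine fun B hB => le_of_forall_lt_imp_le_of_dense fun σ hσρ => ?_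
    rcases lt_or_ge σ 0 with hσ | hσ
    · exact hσ.le.trans (hB (zero_mem_stabilizingParameters ν))
    · exact hB (mem_stabilizingParameters_of_transitionGap_neg hν hl hs hσ
        (hgap ▸ hmono hσ hρ hσρ))

end TransitionDensity

section Reflection

/-- The translation of environments as a measurable equivalence. -/
def shiftEquiv : (ℤ → Label) ≃ᵐ (ℤ → Label) where
  toFun := shift
  invFun ζ := fun x => ζ (x - 1)
  left_inv ζ := by
    funext x
    simp [shift]
  right_inv ζ := by
    funext x
    simp [shift]
  measurable_toFun := measurable_pi_lambda _ fun x => measurable_pi_apply (x + 1)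
  measurable_invFun := measurable_pi_lambda _ fun x => measurable_pi_apply (x - 1)

theorem measurable_reflectEnv : Measurable reflectEnv :=
  measurable_pi_lambda _ fun x =>
    (Measurable.of_discrete (f := Label.flip)).comp (measurable_pi_apply (-x))

theorem reflectEnv_apply_eq_s {ζ : ℤ → Label} {x : ℤ} :
    reflectEnv ζ x = Label.s ↔ ζ (-x) = Label.s :=
  Label.flip_eq_s

theorem IsSparse.reflectEnv {ζ : ℤ → Label} (h : IsSparse ζ) : IsSparse (reflectEnv ζ) := by
  rw [isSparse_int_iff] at h ⊢
  intro x y hxy hx hy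
  have := h (neg_lt_neg hxy) (reflectEnv_apply_eq_s.1 hy) (reflectEnv_apply_eq_s.1 hx)
  omega

theorem measurePreserving_reflectEnv_map (ν : Measure (ℤ → Label)) :
    MeasurePreserving reflectEnv (ν.map reflectEnv) ν where
  measurable := measurable_reflectEnv
  map_eq := by
    have hinvolutive : reflectEnv ∘ reflectEnv = id := funext reflectEnv_reflectEnv
    rw [Measure.map_map measurable_reflectEnv measurable_reflectEnv, hinvolutive, Measure.map_id]

theorem measurePreserving_reflectHeight (r : ℝ≥0) :
    MeasurePreserving (fun (η : ℤ → ℕ) x => η (-x)) (poissonField r) (poissonField r) where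
  measurable := measurable_pi_lambda _ fun x => measurable_pi_apply (-x)
  map_eq := Measure.map_infinitePi_infinitePi_of_inj (P := fun _ : ℤ => poissonMeasure r)
    neg_injective

variable {ν : Measure (ℤ → Label)}

theorem ergodic_shift_map_reflectEnv (hν : Ergodic shift ν) :
    Ergodic shift (ν.map reflectEnv) := by
  have hsymm : Ergodic shiftEquiv.symm ν := Ergodic.symm (e := shiftEquiv) hν
  refine (measurable_reflectEnv.measurePreserving ν).ergodic_of_ergodic_semiconj hsymm
    hν.measurable fun ζ => funext fun x => ?_
  change (ζ (-x - 1)).flip = (ζ (-(x + 1))).flip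
  rw [neg_add']

theorem stabilizingParameters_subset_of_reflectEnv {ν' : Measure (ℤ → Label)} [SFinite ν]
    [SFinite ν'] (h : MeasurePreserving reflectEnv ν ν') :
    stabilizingParameters ν' ⊆ stabilizingParameters ν := fun ρ ⟨hρ, hstab⟩ =>
  ⟨hρ, (((measurePreserving_reflectHeight ρ.toNNReal).prod h).quasiMeasurePreserving.ae hstab).mono
    fun _ => stabilizable_reflectEnv_iff.1⟩

theorem stabilizingParameters_map_reflectEnv [SFinite ν] :
    stabilizingParameters (ν.map reflectEnv) = stabilizingParameters ν :=
  (stabilizingParameters_subset_of_reflectEnv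
      (measurable_reflectEnv.measurePreserving ν)).antisymm
    (stabilizingParameters_subset_of_reflectEnv (measurePreserving_reflectEnv_map ν))

theorem isTransitionDensity_of_ae_ne_r [IsProbabilityMeasure ν] (hν : Ergodic shift ν)
    (hr : ∀ᵐ ζ ∂ν, ∀ x, ζ x ≠ Label.r) (hs : ∀ᵐ ζ ∂ν, IsSparse ζ) {ρ : ℝ} (hρ : 0 ≤ ρ)
    (hgap : transitionGap (ν.real {ζ | ζ 0 = Label.s}) ρ = 0) : IsTransitionDensity ν ρ := by
  have hmap := measurePreserving_reflectEnv_map ν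
  have : IsProbabilityMeasure (ν.map reflectEnv) :=
    Measure.isProbabilityMeasure_map measurable_reflectEnv.aemeasurable
  have hdensity : (ν.map reflectEnv).real {ζ | ζ 0 = Label.s} = ν.real {ζ | ζ 0 = Label.s} := by
    rw [map_measureReal_apply measurable_reflectEnv (measurableSet_label 0 _)]
    simp only [Set.preimage_ofPred_eq, reflectEnv_apply_eq_s, neg_zero]
  rw [IsTransitionDensity, ← stabilizingParameters_map_reflectEnv]
  refine isTransitionDensity_of_ae_ne_l (ergodic_shift_map_reflectEnv hν) ?_ ?_ hρ
    (hdensity ▸ hgap)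
  · filter_upwards [hmap.quasiMeasurePreserving.ae hr] with ζ hζ x hx
    exact hζ (-x) (by simp [reflectEnv, hx, Label.flip])
  · filter_upwards [hmap.quasiMeasurePreserving.ae hs] with ζ hζ
    simpa only [reflectEnv_reflectEnv] using hζ.reflectEnv

theorem isTransitionDensity_of_transitionGap_eq_zero [IsProbabilityMeasure ν]
    (hν : Ergodic shift ν) (hdir : IsDirected ν) (hres : IsRestricted ν) {ρ : ℝ} (hρ : 0 ≤ ρ)
    (hgap : transitionGap (ν.real {ζ | ζ 0 = Label.s}) ρ = 0) : IsTransitionDensity ν ρ := by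
  rcases hdir with hr | hl
  · exact isTransitionDensity_of_ae_ne_r hν (ae_ne_label hν.toMeasurePreserving hr)
      hres.ae_isSparse hρ hgap
  · exact isTransitionDensity_of_ae_ne_l hν (ae_ne_label hν.toMeasurePreserving hl)
      hres.ae_isSparse hρ hgap

end Reflection

section Comparison

theorem measureReal_label_s (ν : Measure (ℤ → Label)) [IsProbabilityMeasure ν] :
    ν.real {ζ | ζ 0 = Label.s} = 1 - directedFraction ν := by
  have hcompl := probReal_compl_eq_one_sub (μ := ν) (measurableSet_label 0 Label.s)
  change directedFraction ν = _ at hcompl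
  rw [hcompl, sub_sub_cancel]

theorem measureReal_label_s_le {ν : Measure (ℤ → Label)} [IsProbabilityMeasure ν]
    (hν : MeasurePreserving shift ν ν) (hres : IsRestricted ν) :
    ν.real {ζ | ζ 0 = Label.s} ≤ 1 / 3 := by
  have hreal : ∀ x, ν.real {ζ | ζ x = Label.s} = ν.real {ζ | ζ 0 = Label.s} := fun x => by
    rw [measureReal_def, measure_label_eq hν, measureReal_def]
  have hpair : ν.real ({ζ | ζ 0 = Label.s} ∪ {ζ | ζ 1 = Label.s}) =
      2 * ν.real {ζ | ζ 0 = Label.s} := by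
    have hdisjoint : AEDisjoint ν {ζ | ζ 0 = Label.s} {ζ | ζ 1 = Label.s} := (hres 0).1
    rw [measureReal_union₀ (measurableSet_label 1 _).nullMeasurableSet hdisjoint, hreal 1,
      two_mul]
  have htriple : ν.real (({ζ | ζ 0 = Label.s} ∪ {ζ | ζ 1 = Label.s}) ∪ {ζ | ζ 2 = Label.s}) =
      3 * ν.real {ζ | ζ 0 = Label.s} := by
    have hdisjoint : AEDisjoint ν ({ζ | ζ 0 = Label.s} ∪ {ζ | ζ 1 = Label.s})
        {ζ | ζ 2 = Label.s} := AEDisjoint.union_left (hres 0).2 (hres 1).1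
    rw [measureReal_union₀ (measurableSet_label 2 _).nullMeasurableSet hdisjoint, hpair, hreal 2]
    ring
  linarith [measureReal_le_one (μ := ν)
    (s := ({ζ | ζ 0 = Label.s} ∪ {ζ | ζ 1 = Label.s}) ∪ {ζ | ζ 2 = Label.s})]

theorem transitionGap_stationaryDensity_ne_zero {f : ℝ} (hf0 : 0 ≤ f) (hf : f ≤ 1 / 3) :
    transitionGap f (1 / 2 + f / 2) ≠ 0 := by
  have hlt : Real.exp (-2 * (1 / 2 + f / 2)) < 1 := Real.exp_lt_one_iff.2 (by linarith)
  have hpos : 0 < Real.exp (-2 * (1 / 2 + f / 2)) := Real.exp_pos _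
  rw [transitionGap]
  generalize Real.exp (-2 * (1 / 2 + f / 2)) = e at *
  have hfactor : 0 < 1 - f * (2 + e) := by nlinarith
  have hgap : 1 / 2 + f / 2 - 1 / 2 * (1 - e) - f / 2 * (1 + e) ^ 2 =
      e * (1 - f * (2 + e)) / 2 := by ring
  rw [hgap]
  positivity

end Comparison

end Sandpile

theorem mainTheorem2 (ν : MeasureTheory.Measure (ℤ → Sandpile.Label))
    [MeasureTheory.IsProbabilityMeasure ν]
    (hν : Ergodic Sandpile.shift ν)
    (hdir : Sandpile.IsDirected ν)
    (hres : Sandpile.IsRestricted ν) :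
    ∃ ρs ρtr : ℝ,
      (∀ μ : MeasureTheory.Measure (ℕ → Fin 2), MeasureTheory.IsProbabilityMeasure μ →
        Sandpile.IsStationaryDensity μ ν ρs) ∧
      ρs = 1 - Sandpile.directedFraction ν / 2 ∧
      Sandpile.IsTransitionDensity ν ρtr ∧
      (∀ ρ : ℝ,
        (0 ≤ ρ ∧ ρ - 1 / 2 * (1 - Real.exp (-2 * ρ)) =
          (1 - Sandpile.directedFraction ν) / 2 * (1 + Real.exp (-2 * ρ)) ^ 2) ↔ ρ = ρtr) ∧
      ρs ≠ ρtr := by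
  have hf_eq := Sandpile.measureReal_label_s ν
  have hf_le := Sandpile.measureReal_label_s_le hν.toMeasurePreserving hres
  have hf_nonneg : 0 ≤ ν.real {ζ | ζ 0 = Sandpile.Label.s} := measureReal_nonneg
  obtain ⟨ρ, hρ, hgap⟩ := Sandpile.exists_transitionGap_eq_zero hf_nonneg
  refine ⟨1 / 2 + ν.real {ζ | ζ 0 = Sandpile.Label.s} / 2, ρ,
    fun μ _ => Sandpile.isStationaryDensity hν.toMeasurePreserving hdir hres μ, by linarith,
    Sandpile.isTransitionDensity_of_transitionGap_eq_zero hν hdir hres hρ hgap,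
    fun σ => ?_, ?_⟩
  · rw [← hf_eq, ← sub_eq_zero]
    refine ⟨fun ⟨hσ, hσgap⟩ => ?_, fun h => h ▸ ⟨hρ, hgap⟩⟩
    exact (Sandpile.strictMonoOn_transitionGap hf_nonneg).injOn hσ hρ (hσgap.trans hgap.symm)
  · rintro rfl
    exact Sandpile.transitionGap_stationaryDensity_ne_zero hf_nonneg hf_le hgap
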